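/- All graphs are finite and simple, and graphs are considered up to isomorphism. For a graph $G$ let $n(G)$ be its number of vertices, $t(G)$ its number of spanning trees, $\overline{G}$ its complement, $A(G)$ its adjacency matrix and $L(G)$ its Laplacian matrix. Let $\mathcal{S}(G)$ be the class of graphs with as many vertices and as many edges as $G$; $G$ is $t$-optimal if $t(G)\ge t(H)$ for every $H\in\mathcal{S}(G)$. Let $\mathcal{R}_k(n)$ be the class of $k$-regular graphs on $n$ vertices. A graph $G\in\mathcal{R}_k(n)$ is trace-minimal if for every $H\in\mathcal{R}_k(n)$ either $\operatorname{tr}(A(G)^i)=\operatorname{tr}(A(H)^i)$ for all $i\ge 1$, or there is $j\ge 1$ with $\operatorname{tr}(A(G)^i)\le\operatorname{tr}(A(H)^i)$ for $1\le i<j$ and $\operatorname{tr}(A(G)^j)<\operatorname{tr}(A(H)^j)$. Put $\mathcal{S}(G)^{(1)}=\mathcal{S}(G)$ and, for $k\ge 1$, let $\mathcal{S}(G)^{(k+1)}$ be the class of those graphs in $\mathcal{S}(G)^{(k)}$ that minimize $\operatorname{tr}(L(\cdot)^{k+1})$ over $\mathcal{S}(G)^{(k)}$. **Theorem.** Let $G_0$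 be a $d$-regular graph and, for each integer $p\ge 0$, let $G_0(p)=G_0\cup pK_{d+1}$ be the disjoint union of $G_0$ and $p$ copies of the complete graph $K_{d+1}$. Suppose that for each positive integer $p$ the graph $\overline{G_0(p)}$ is the only trace-minimal graph in $\mathcal{R}_{n-1-d}(n)$, where $n=n(G_0(p))$. Then there exists a positive integer $n_0$ such that, for every $p\ge 0$ with $n(G_0(p))\ge n_0$, the graph $\overline{G_0(p)}$ is the only $t$-optimal graph in $\mathcal{S}(\overline{G_0(p)})$. If, in addition, $c$ is a positive integer such that for each positive integer $p$ no graph $H\in\mathcal{S}(G_0(p))$ other than $G_0(p)$ belongs to $\mathcal{S}(G_0(p))^{(c+1)}$, then the conclusion holds with $n_0=2d+n(G_0)(2d)^{c+2}$, that is, $\overline{G_0(p)}$ is the only $t$-optimal graph in $\mathcal{S}(\overline{G_0(p)})$ for every $p\ge 0$ with $n(G_0(p))\ge 2d+n(G_0)(2d)^{c+2}$. -/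

import Mathlib

open scoped SimpleGraph

namespace TOpt

/-! All classes of graphs are taken on one finite vertex type `V`: every graph with `|V|` vertices is
isomorphic to a graph on `V`, and "the only graph" always means "the only graph up to isomorphism". -/

/-- The class of simple graphs on `V` with exactly `m` edges. -/
def edgeClass (V : Type*) [Fintype V] (m : ℕ) : Set (SimpleGraph V) :=
  {G | G.edgeSet.ncard = m}

open Classical in
/-- The class of `d`-regular graphs on `V`. -/
def regularClass (V : Type*) [Fintype V] (d : ℕ) : Set (SimpleGraph V) :=
  {G | G.IsRegularOfDegree d}

open Classical in
/-- The adjacency sequence `a_i(G) = tr (A(G)^i)`. -/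
noncomputable def adjSeq {V : Type*} [Fintype V] (G : SimpleGraph V) (i : ℕ) : ℝ :=
  (G.adjMatrix ℝ ^ i).trace

open Classical in
/-- The Laplacian sequence `ℓ_i(G) = tr (L(G)^i)`. -/
noncomputable def lapSeq {V : Type*} [Fintype V] (G : SimpleGraph V) (i : ℕ) : ℝ :=
  (G.lapMatrix ℝ ^ i).trace

/-- The order `b ⪯ c` on real sequences indexed by the positive integers (the values at index `0`
are ignored). -/
def SeqLE (b c : ℕ → ℝ) : Prop :=
  (∀ i, 1 ≤ i → b i = c i) ∨
    ∃ j, 1 ≤ j ∧ (∀ i, 1 ≤ i → i < j → b i ≤ c i) ∧ b j < c j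

/-- `G` is trace-minimal in the class of `k`-regular graphs on `V`. -/
def IsTraceMinimal {V : Type*} [Fintype V] (k : ℕ) (G : SimpleGraph V) : Prop :=
  G ∈ regularClass V k ∧ ∀ H ∈ regularClass V k, SeqLE (adjSeq G) (adjSeq H)

/-- `G` is the only trace-minimal graph in the class of `k`-regular graphs on `V`. -/
def IsOnlyTraceMinimal {V : Type*} [Fintype V] (k : ℕ) (G : SimpleGraph V) : Prop :=
  IsTraceMinimal k G ∧ ∀ H : SimpleGraph V, IsTraceMinimal k H → Nonempty (H ≃g G)

/-- The number `t(G)` of spanning trees of `G`. -/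
noncomputable def numSpanningTrees {V : Type*} (G : SimpleGraph V) : ℕ :=
  {T : SimpleGraph V | T ≤ G ∧ T.IsTree}.ncard

/-- `G` is `t`-optimal: it has the maximum number of spanning trees among the graphs with as many
vertices and edges as `G`. -/
def IsTOptimal {V : Type*} [Fintype V] (G : SimpleGraph V) : Prop :=
  ∀ H ∈ edgeClass V G.edgeSet.ncard, numSpanningTrees H ≤ numSpanningTrees G

/-- `G` is the only `t`-optimal graph among the graphs with as many vertices and edges as `G`. -/
def IsOnlyTOptimal {V : Type*} [Fintype V] (G : SimpleGraph V) : Prop :=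
  IsTOptimal G ∧ ∀ H ∈ edgeClass V G.edgeSet.ncard, IsTOptimal H → Nonempty (H ≃g G)

/-- `lapClass V m k` is the class `S_{n,m}^{(k)}`, `k ≥ 1`, with `n = |V|`: the first class consists
of all graphs with `m` edges, and the class with index `k + 1` consists of the graphs in the class
with index `k` that minimize `ℓ_{k+1}` there. The value at `k = 0` is a dummy. -/
def lapClass (V : Type*) [Fintype V] (m : ℕ) : ℕ → Set (SimpleGraph V)
  | 0 => edgeClass V m
  | 1 => edgeClass V m
  | k + 2 => {G | G ∈ lapClass V m (k + 1) ∧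
      ∀ H ∈ lapClass V m (k + 1), lapSeq G (k + 2) ≤ lapSeq H (k + 2)}

/-- The disjoint union `pK_k` of `p` copies of the complete graph on `k` vertices. -/
def copiesOfComplete (p k : ℕ) : SimpleGraph (Fin p × Fin k) where
  Adj x y := x.1 = y.1 ∧ x.2 ≠ y.2
  symm := ⟨fun _ _ h => ⟨h.1.symm, h.2.symm⟩⟩
  loopless := ⟨fun _ h => h.2 rfl⟩

/-- The graph `G₀(p) = G₀ ∪ pK_{d+1}` (disjoint union). -/
def addCompletes {V : Type*} (G₀ : SimpleGraph V) (d p : ℕ) :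
    SimpleGraph (V ⊕ Fin p × Fin (d + 1)) :=
  G₀ ⊕g copiesOfComplete p (d + 1)

end TOpt

/-! Write `n` for the number of vertices, `ℓ_k` for the trace of the `k`-th power of the Laplacian,
and `J` for the all-ones matrix. The matrix-tree theorem gives `n² t(Gᶜ) = ∏ (n - λ_i(G))`
(`prod_card_sub_lapEig`). When all `λ_i < n`, taking logarithms turns the product into a constant
minus `∑ ℓ_k(G) / (k n^k)`. For large `n`, maximizing `t(Gᶜ)` therefore means minimizing the
sequence `ℓ` lexicographically.

To quantify this, let `G = G₀(p)` and let `ℓ(H)` first exceed `ℓ(G)` at index `j`. The gap is an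
integer, so it gains at least `1 / (j n^j)`. Each vertex in a copy of `K_{d+1}` contributes exactly
`d(d+1)^(k-1)` to `ℓ_k(G)`, and each vertex of `G₀` at most `(2d)^k`. On the other side, `ℓ_k(H) ≥ n
d (d+1)^(k-1)`. The later terms thus lose at most `n(G₀) ∑_{k>j} (2d/n)^k / k`, which is less than
the gain once `n > 2d` and `n ≥ 2d + n(G₀)(2d)^(j+1)` (`numSpanningTrees_compl_lt`).

Such a `j` exists. A nonregular `H` loses at index 2. For regular `H`, the identity `L(G) + J =
A(Gᶜ) + (d+1)I` transfers trace-minimality of the complement to `ℓ`.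

It remains to bound `j` independently of `p`. The extra hypothesis on `c` yields `j ≤ c + 1`.
Without it, the third moment bounds the number of eigenvalues other than `0` and `d + 1`, so the
power sums obey a recurrence of bounded order (`firstDiff_le`). -/

namespace TOpt

open Matrix Finset

/-! ### The matrix-tree theorem, by expansion over parent maps -/

section MatrixTree

variable {V : Type*} [Fintype V] [DecidableEq V]

/-- Every vertex is sent to the root `r` by some iterate of `f`. -/
def ReachesRoot (r : V) (f : V → V) : Prop := ∀ v, ∃ k, f^[k] v = r

/-- The matrix with rows `e_v - e_{f v}` for `v ≠ r`, and `e_r` for the root. -/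
def parentMatrix (r : V) (f : V → V) : Matrix V V ℝ :=
  fun v => if v = r then Pi.single r 1 else Pi.single v 1 - Pi.single (f v) 1

/-- Ordered by the number of steps to the root, the matrix is triangular with unit diagonal. -/
theorem det_parentMatrix_of_reachesRoot {r : V} {f : V → V} (h : ReachesRoot r f) :
    (parentMatrix r f).det = 1 := by
  classical
  let b : V → ℕᵒᵈ := fun v => OrderDual.toDual (Nat.find (h v))
  have hlt : ∀ v, v ≠ r → Nat.find (h (f v)) < Nat.find (h v) := by
    intro v hv
    have hs := Nat.find_spec (h v)
    obtain ⟨k, hk⟩ : ∃ k, Nat.find (h v) = k + 1 := by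
      refine Nat.exists_eq_succ_of_ne_zero fun h0 => hv ?_
      rw [h0] at hs
      exact hs
    rw [hk] at hs ⊢
    exact Nat.lt_succ_of_le (Nat.find_min' _ hs)
  have hentry : ∀ v w, v ≠ w → Nat.find (h v) ≤ Nat.find (h w) → parentMatrix r f v w = 0 := by
    intro v w hvw hle
    unfold parentMatrix
    split_ifs with hv
    · simp [← hv, hvw.symm]
    · have := hlt v hv
      have hne : w ≠ f v := by
        rintro rfl
        omega
      simp [hvw.symm, hne]
  have hb : (parentMatrix r f).BlockTriangular b := by
    intro v w hvw
    have : Nat.find (h v) < Nat.find (h w) := hvw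
    exact hentry v w (by rintro rfl; exact lt_irrefl _ this) this.le
  rw [hb.det]
  refine Finset.prod_eq_one fun a _ => ?_
  have : (parentMatrix r f).toSquareBlock b a = 1 := by
    ext ⟨v, hv⟩ ⟨w, hw⟩
    rw [Matrix.toSquareBlock_def, Matrix.of_apply, Matrix.one_apply]
    split_ifs with hvw
    · have hvw' : v = w := congrArg Subtype.val hvw
      change parentMatrix r f v w = 1
      rw [← hvw']
      unfold parentMatrix
      split_ifs with hvr
      · simp [hvr]
      · have hne : v ≠ f v := fun h' => by
          have := hlt v hvr
          rw [← h'] at this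
          exact lt_irrefl _ this
        simp [hne]
    · refine hentry v w (fun h' => hvw (Subtype.ext h')) (le_of_eq ?_)
      exact OrderDual.toDual.injective (hv.trans hw.symm)
  rw [this, det_one]

/-- The indicator of the vertices that never reach the root is a nonzero kernel vector. -/
theorem det_parentMatrix_of_not_reachesRoot {r : V} {f : V → V} (hr : f r = r)
    (h : ¬ ReachesRoot r f) : (parentMatrix r f).det = 0 := by
  classical
  rw [← Matrix.exists_mulVec_eq_zero_iff]
  unfold ReachesRoot at h
  push Not at h
  obtain ⟨v, hv⟩ := h
  refine ⟨fun w => if ∃ k, f^[k] w = r then 0 else 1, ?_, ?_⟩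
  · intro h0
    have := congrFun h0 v
    simp [hv] at this
  · ext w
    change parentMatrix r f w ⬝ᵥ _ = 0
    by_cases hw : w = r
    · rw [parentMatrix, if_pos hw, single_one_dotProduct, if_pos ⟨0, rfl⟩]
    · have key : (∃ k, f^[k] w = r) ↔ ∃ k, f^[k] (f w) = r := by
        constructor
        · rintro ⟨k, hk⟩
          refine ⟨k, ?_⟩
          rw [← Function.iterate_succ_apply, Function.iterate_succ_apply', hk, hr]
        · rintro ⟨k, hk⟩
          exact ⟨k + 1, hk⟩
      rw [parentMatrix, if_neg hw, sub_dotProduct, single_one_dotProduct, single_one_dotProduct]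
      simp [key]

/-- The graph whose edges join each vertex `v ≠ r` to its parent `f v`. -/
def parentGraph (r : V) (f : V → V) : SimpleGraph V :=
  SimpleGraph.fromRel fun v w => v ≠ r ∧ f v = w

omit [Fintype V] in
theorem parentGraph_reachable {r : V} {f : V → V} (k : ℕ) :
    ∀ v, f^[k] v = r → (parentGraph r f).Reachable v r := by
  induction k with
  | zero =>
    rintro v rfl
    exact SimpleGraph.Reachable.refl _
  | succ k ih =>
    intro v hv
    by_cases hvr : v = r
    · rw [hvr]
    by_cases hf : v = f v
    · exact ih v (by rwa [Function.iterate_succ_apply, ← hf] at hv)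
    · refine SimpleGraph.Reachable.trans (SimpleGraph.Adj.reachable ?_) (ih (f v) hv)
      exact ⟨hf, Or.inl ⟨hvr, rfl⟩⟩

omit [Fintype V] in
theorem ReachesRoot.connected {r : V} {f : V → V} (h : ReachesRoot r f) :
    (parentGraph r f).Connected := by
  have : Nonempty V := ⟨r⟩
  have hr : ∀ v, (parentGraph r f).Reachable v r := fun v =>
    (h v).elim fun k hk => parentGraph_reachable k v hk
  exact ⟨fun v w => (hr v).trans (hr w).symm⟩

theorem ReachesRoot.isTree {r : V} {f : V → V} (h : ReachesRoot r f) :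
    (parentGraph r f).IsTree := by
  classical
  rw [SimpleGraph.isTree_iff_connected_and_card]
  refine ⟨h.connected, le_antisymm ?_ h.connected.card_vert_le_card_edgeSet_add_one⟩
  have hsub : (parentGraph r f).edgeSet ⊆
      ((univ.erase r).image fun v => s(v, f v) : Finset (Sym2 V)) := by
    intro e
    induction e using Sym2.ind with
    | _ v w =>
      rintro ⟨-, ⟨h1, h2⟩ | ⟨h1, h2⟩⟩
      · simp only [coe_image, Set.mem_image, mem_coe, mem_erase, mem_univ, and_true]
        exact ⟨v, h1, by rw [h2]⟩
      · simp only [coe_image, Set.mem_image, mem_coe, mem_erase, mem_univ, and_true]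
        exact ⟨w, h1, by rw [h2, Sym2.eq_swap]⟩
  have h1 := Set.ncard_le_ncard hsub (Finset.finite_toSet _)
  rw [Set.ncard_coe_finset] at h1
  have h2 := h1.trans Finset.card_image_le
  rw [Finset.card_erase_of_mem (mem_univ r), Finset.card_univ] at h2
  have h3 : 0 < Fintype.card V := Fintype.card_pos_iff.2 ⟨r⟩
  rw [Nat.card_eq_fintype_card (α := V), Nat.card_coe_set_eq]
  omega

/-- If `f` and `g` differ at `w`, the edge from `w` to `f w` must come from `g (f w) = w`. Were they
to agree at `f w`, `f` would have a 2-cycle avoiding the root. So the disagreement travels along the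
`f`-orbit and never meets `r`. -/
theorem parentGraph_injOn (r : V) :
    Set.InjOn (parentGraph r) {f | f r = r ∧ (∀ v, v ≠ r → f v ≠ v) ∧ ReachesRoot r f} := by
  rintro f ⟨hfr, hf1, hf⟩ g ⟨hgr, hg1, hg⟩ hfg
  have key : ∀ v, v ≠ r → f v = g v ∨ (f v ≠ r ∧ g (f v) = v) := by
    intro v hv
    have h1 : (parentGraph r f).Adj v (f v) := ⟨(hf1 v hv).symm, Or.inl ⟨hv, rfl⟩⟩
    rw [hfg] at h1
    obtain ⟨-, ⟨-, h⟩ | ⟨h, h'⟩⟩ := h1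
    · exact Or.inl h.symm
    · exact Or.inr ⟨h, h'⟩
  by_contra hne
  obtain ⟨v, hv⟩ := Function.ne_iff.1 hne
  have hvr : v ≠ r := by
    rintro rfl
    exact hv (hfr.trans hgr.symm)
  have step : ∀ k, f^[k] v ≠ r ∧ f (f^[k] v) ≠ g (f^[k] v) := by
    intro k
    induction k with
    | zero => exact ⟨hvr, hv⟩
    | succ k ih =>
      rw [Function.iterate_succ_apply']
      set w := f^[k] v
      obtain ⟨h1, h2⟩ := (key w ih.1).resolve_left ih.2
      refine ⟨h1, fun h3 => ?_⟩
      rw [h2] at h3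
      have hcyc : ∀ m, f^[m] w = w ∨ f^[m] w = f w := by
        intro m
        induction m with
        | zero => exact Or.inl rfl
        | succ m im =>
          rw [Function.iterate_succ_apply']
          rcases im with im | im
          · exact Or.inr (by rw [im])
          · exact Or.inl (by rw [im, h3])
      obtain ⟨m, hm⟩ := hf w
      rcases hcyc m with h | h
      · exact ih.1 (h.symm.trans hm)
      · exact h1 (h.symm.trans hm)
  obtain ⟨k, hk⟩ := hf v
  exact (step k).1 hk

-- The parent of a vertex is a neighbour closer to `r`. The parent graph is then a connected
-- subgraph of `T`, hence all of it, since trees are minimally connected.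
omit [Fintype V] in
theorem exists_parentGraph_eq {T : SimpleGraph V} (hT : T.IsTree) (r : V) :
    ∃ f : V → V, f r = r ∧ (∀ v, v ≠ r → T.Adj v (f v)) ∧ ReachesRoot r f ∧
      parentGraph r f = T := by
  have hc : T.Connected := hT.connected
  have hex : ∀ v, ∃ w, v ≠ r → T.Adj v w ∧ T.dist w r < T.dist v r := by
    intro v
    by_cases hv : v = r
    · exact ⟨v, fun h => absurd hv h⟩
    · obtain ⟨p, hp⟩ := (hc v r).exists_walk_length_eq_dist
      cases p with
      | nil => exact absurd rfl hv
      | cons h q =>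
        refine ⟨_, fun _ => ⟨h, ?_⟩⟩
        rw [← hp, SimpleGraph.Walk.length_cons]
        exact Nat.lt_succ_of_le (SimpleGraph.dist_le q)
  choose g hg using hex
  have hroot : ReachesRoot r (fun v => if v = r then r else g v) := by
    intro v
    induction hd : T.dist v r using Nat.strong_induction_on generalizing v with
    | _ m ih =>
      by_cases hv : v = r
      · exact ⟨0, hv⟩
      · obtain ⟨k, hk⟩ := ih _ (hd ▸ (hg v hv).2) (g v) rfl
        refine ⟨k + 1, ?_⟩
        rw [Function.iterate_succ_apply, if_neg hv, hk]
  have hadj : ∀ v, v ≠ r → T.Adj v (if v = r then r else g v) := fun v hv => by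
    rw [if_neg hv]
    exact (hg v hv).1
  have hle : parentGraph r (fun v => if v = r then r else g v) ≤ T := by
    rintro v w ⟨-, ⟨h1, h2⟩ | ⟨h1, h2⟩⟩
    · exact h2 ▸ hadj v h1
    · exact h2 ▸ (hadj w h1).symm
  exact ⟨fun v => if v = r then r else g v, by simp, hadj, hroot,
    le_antisymm hle ((SimpleGraph.isTree_iff_minimal_connected.1 hT).2 hroot.connected hle)⟩

variable (G : SimpleGraph V) [DecidableRel G.Adj]

theorem numSpanningTrees_eq_card (r : V) [DecidablePred (ReachesRoot r)] :
    numSpanningTrees G = #{f ∈ Fintype.piFinset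
      (fun v => if v = r then {r} else G.neighborFinset v) | ReachesRoot r f} := by
  have himg : {T : SimpleGraph V | T ≤ G ∧ T.IsTree} = parentGraph r ''
      ({f ∈ Fintype.piFinset
      (fun v => if v = r then {r} else G.neighborFinset v) | ReachesRoot r f} : Finset (V → V)) := by
    ext T
    simp only [Set.mem_ofPred_eq, coe_filter, Fintype.mem_piFinset, Set.mem_image]
    constructor
    · rintro ⟨hle, hT⟩
      obtain ⟨f, h1, h2, h3, h4⟩ := exists_parentGraph_eq hT r
      refine ⟨f, ⟨fun v => ?_, h3⟩, h4⟩
      split_ifs with hv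
      · simp [hv, h1]
      · simpa using hle (h2 v hv)
    · rintro ⟨f, ⟨h1, h2⟩, rfl⟩
      refine ⟨?_, h2.isTree⟩
      have h1' : ∀ v, v ≠ r → G.Adj v (f v) := fun v hv => by simpa [hv] using h1 v
      rintro v w ⟨-, ⟨h3, h4⟩ | ⟨h3, h4⟩⟩
      · exact h4 ▸ h1' v h3
      · exact h4 ▸ (h1' w h3).symm
  rw [numSpanningTrees, himg, Set.InjOn.ncard_image, Set.ncard_coe_finset]
  refine (parentGraph_injOn r).mono ?_
  intro f hf
  simp only [coe_filter, Fintype.mem_piFinset, Set.mem_ofPred_eq] at hf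
  refine ⟨by simpa using hf.1 r, fun v hv h => ?_, hf.2⟩
  have := hf.1 v
  simp [hv, h] at this

theorem lapMatrix_row (v : V) :
    G.lapMatrix ℝ v = ∑ w ∈ G.neighborFinset v, (Pi.single v 1 - Pi.single w 1) := by
  ext x
  rw [SimpleGraph.lapMatrix, SimpleGraph.degMatrix, Matrix.sub_apply, Matrix.diagonal_apply,
    SimpleGraph.adjMatrix_apply, Finset.sum_apply]
  simp only [Pi.sub_apply, Finset.sum_sub_distrib, Finset.sum_const, Pi.single_apply,
    SimpleGraph.card_neighborFinset_eq_degree,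
    nsmul_eq_mul, eq_comm (a := x)]
  simp

/-- The **matrix-tree theorem**, with the root row of the Laplacian replaced by a unit vector. -/
theorem det_lapMatrix_updateRow (r : V) :
    ((G.lapMatrix ℝ).updateRow r (Pi.single r 1)).det = numSpanningTrees G := by
  classical
  have hrows : (G.lapMatrix ℝ).updateRow r (Pi.single r 1) = fun v =>
      ∑ w ∈ (if v = r then {r} else G.neighborFinset v),
        (if v = r then Pi.single r 1 else Pi.single v 1 - Pi.single w 1 : V → ℝ) := by
    funext v
    by_cases hv : v = r
    · subst hv
      rw [Matrix.updateRow, if_pos rfl, Finset.sum_singleton, if_pos rfl]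
      exact Function.update_self ..
    · rw [Matrix.updateRow_ne hv, lapMatrix_row]
      simp [hv]
  -- Multilinearity in the rows gives one determinant for each choice of a neighbour at every `v ≠
  -- r`, that is, for each parent map.
  have hdet : ∀ M : Matrix V V ℝ, M.det = (detRowAlternating (R := ℝ) (n := V)).toMultilinearMap M :=
    fun _ => rfl
  rw [hdet, hrows, MultilinearMap.map_sum_finset, numSpanningTrees_eq_card G r, card_filter,
    Nat.cast_sum]
  refine Finset.sum_congr rfl fun f hf => ?_
  rw [Fintype.mem_piFinset] at hf
  change (parentMatrix r f).det = _
  split_ifs with h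
  · rw [det_parentMatrix_of_reachesRoot h, Nat.cast_one]
  · rw [det_parentMatrix_of_not_reachesRoot (by simpa using hf r) h, Nat.cast_zero]

theorem lapMatrix_row_sum (v : V) : ∑ w, G.lapMatrix ℝ v w = 0 := by
  have := congrFun (G.lapMatrix_mulVec_const_eq_zero (R := ℝ)) v
  simpa [Matrix.mulVec, dotProduct] using this

theorem lapMatrix_col_sum (w : V) : ∑ v, G.lapMatrix ℝ v w = 0 := by
  rw [← lapMatrix_row_sum G w]
  exact Finset.sum_congr rfl fun v _ => (G.isSymm_lapMatrix (R := ℝ)).apply w v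

/-- The **matrix-tree theorem** in the form `det (L + J) = n² t(G)`. -/
theorem det_lapMatrix_add_one [Nonempty V] :
    (G.lapMatrix ℝ + Matrix.of fun _ _ => (1 : ℝ)).det =
      (Fintype.card V : ℝ) ^ 2 * numSpanningTrees G := by
  obtain ⟨r⟩ := ‹Nonempty V›
  set L := G.lapMatrix ℝ with hL
  set n : ℝ := ((Fintype.card V : ℕ) : ℝ) with hn
  have hn0 : n ≠ 0 := Nat.cast_ne_zero.2 (Fintype.card_pos_iff.2 ⟨r⟩).ne'
  let N : Matrix V V ℝ := L.updateRow r fun _ => 1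
  -- The rows of `L + J` average to the all-ones row, which then clears `J` from the other rows.
  have h1 : (L + Matrix.of fun _ _ => (1 : ℝ)).det = n * N.det := by
    set A : Matrix V V ℝ := L + Matrix.of fun _ _ => (1 : ℝ) with hA
    have e1 := det_updateRow_sum A r fun _ => n⁻¹
    have e2 : (A.updateRow r (∑ k, n⁻¹ • A k)).det = N.det := by
      refine det_eq_of_forall_row_eq_smul_add_const (fun v => if v = r then 0 else 1) r
        (by simp) fun v w => ?_
      by_cases hv : v = r
      · have hc : (∑ k, n⁻¹ • A k) w = 1 := by
          refine (Finset.sum_apply w univ fun k => n⁻¹ • A k).trans ?_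
          change ∑ k, n⁻¹ * (L k w + 1) = 1
          rw [← Finset.mul_sum, Finset.sum_add_distrib, hL, lapMatrix_col_sum]
          simp [← hn, hn0]
        rw [hv, Matrix.updateRow_self, hc]
        simp [N]
      · simp [N, hv, hA]
    rw [e2, smul_eq_mul] at e1
    rw [e1]
    field_simp
  -- The rows of `N` sum to `0`, except row `r`, which sums to `n`. Adding all columns into column
  -- `r` leaves `n` times the unit vector there.
  have h2 : n * (L.updateRow r (Pi.single r 1)).det = N.det := by
    have e1 := det_updateRow_sum Nᵀ r fun _ => 1
    have e2 : (Nᵀ.updateRow r (∑ k, (1 : ℝ) • Nᵀ k)).det =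
        n * (L.updateRow r (Pi.single r 1)).det := by
      let K : Matrix V V ℝ := Matrix.of fun v w =>
        if v = r then (if w = r then 1 else 0) else if w = r then 0 else L v w
      have hK1 : (L.updateRow r (Pi.single r 1)).det = K.det := by
        refine det_eq_of_forall_row_eq_smul_add_const (fun v => if v = r then 0 else L v r) r
          (by simp) fun v w => ?_
        by_cases hv : v = r <;> by_cases hw : w = r <;> simp [K, hv, hw]
      have hK2 : (Nᵀ.updateRow r (Pi.single r 1)).det = Kᵀ.det := by
        refine det_eq_of_forall_row_eq_smul_add_const (fun v => if v = r then 0 else 1) r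
          (by simp) fun v w => ?_
        by_cases hv : v = r <;> by_cases hw : w = r <;> simp [K, N, hv, hw]
      have hsum : ∑ k, (1 : ℝ) • Nᵀ k = n • (Pi.single r 1 : V → ℝ) := by
        ext v
        refine (Finset.sum_apply v univ fun k => (1 : ℝ) • Nᵀ k).trans ?_
        change ∑ k, (1 : ℝ) * N v k = n * (Pi.single r 1 : V → ℝ) v
        by_cases hv : v = r
        · simp [N, hv, hn]
        · simp [N, hv, hL, lapMatrix_row_sum]
      rw [hsum, det_updateRow_smul, hK2, hK1, det_transpose]
    rw [e2, one_smul, det_transpose] at e1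
    exact e1
  rw [h1, ← h2, hL, det_lapMatrix_updateRow]
  ring

end MatrixTree

/-! ### Comparing products through power sums -/

section PowerSums

variable {ι : Type*} [Fintype ι]

theorem hasSum_neg_log_prod {n : ℝ} {μ : ι → ℝ} (h0 : ∀ i, 0 ≤ μ i) (hn : ∀ i, μ i < n) :
    HasSum (fun k : ℕ => (∑ i, μ i ^ (k + 1)) / n ^ (k + 1) / (k + 1))
      (-∑ i, Real.log (1 - μ i / n)) := by
  have h : ∀ i ∈ (univ : Finset ι), HasSum (fun k : ℕ => (μ i / n) ^ (k + 1) / (k + 1))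
      (-Real.log (1 - μ i / n)) := fun i _ => by
    have hnpos : 0 < n := (h0 i).trans_lt (hn i)
    refine Real.hasSum_pow_div_log_of_abs_lt_one ?_
    rw [abs_of_nonneg (div_nonneg (h0 i) hnpos.le), div_lt_one hnpos]
    exact hn i
  have := hasSum_sum h
  rw [Finset.sum_neg_distrib] at this
  convert this using 2 with k
  simp_rw [div_pow, Finset.sum_div]

/-- If the power sums of `μ` and `ν` first differ at the exponent `j`, where those of `μ` are larger
by at least `1`, and later power sums of `μ` are not much smaller, then `∏ (n - μ i)` is smaller
than `∏ (n - ν i)`. -/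
theorem prod_sub_lt_prod_sub {n b B : ℝ} {j : ℕ} {μ ν : ι → ℝ} (hn0 : 0 < n)
    (hμ0 : ∀ i, 0 ≤ μ i) (hμ : ∀ i, μ i < n) (hν0 : ∀ i, 0 ≤ ν i) (hν : ∀ i, ν i < n)
    (hj : 1 ≤ j) (hlt : ∀ k, 1 ≤ k → k < j → ∑ i, μ i ^ k = ∑ i, ν i ^ k)
    (heq : ∑ i, ν i ^ j + 1 ≤ ∑ i, μ i ^ j)
    (hgt : ∀ k, j < k → ∑ i, ν i ^ k - B * b ^ k ≤ ∑ i, μ i ^ k)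
    (hB : 0 ≤ B) (hb : 0 ≤ b) (hbn : b < n) (hBn : B * b ^ (j + 1) ≤ n - b) :
    ∏ i, (n - μ i) < ∏ i, (n - ν i) := by
  have hpos : ∀ {x : ℝ}, x < n → 0 < 1 - x / n := fun hx => by
    rw [sub_pos, div_lt_one hn0]
    exact hx
  suffices hlog : ∑ i, Real.log (1 - μ i / n) < ∑ i, Real.log (1 - ν i / n) by
    rw [← Real.log_prod fun i _ => (hpos (hμ i)).ne', ← Real.log_prod fun i _ => (hpos (hν i)).ne',
      Real.log_lt_log_iff (prod_pos fun i _ => hpos (hμ i)) (prod_pos fun i _ => hpos (hν i))] at hlog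
    have hfac : ∀ x : ι → ℝ, ∏ i, (n - x i) = n ^ Fintype.card ι * ∏ i, (1 - x i / n) := by
      intro x
      rw [← Finset.card_univ, ← Finset.prod_const, ← Finset.prod_mul_distrib]
      refine prod_congr rfl fun i _ => ?_
      field_simp
    rw [hfac, hfac]
    exact mul_lt_mul_of_pos_left hlog (pow_pos hn0 _)
  have hs := (hasSum_neg_log_prod hμ0 hμ).sub (hasSum_neg_log_prod hν0 hν)
  obtain ⟨m, rfl⟩ : ∃ m, j = m + 1 := ⟨j - 1, by omega⟩
  set f : ℕ → ℝ := fun k => (∑ i, μ i ^ (k + 1)) / n ^ (k + 1) / (k + 1) -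
    (∑ i, ν i ^ (k + 1)) / n ^ (k + 1) / (k + 1) with hf
  have hf' : ∀ k, f k = (∑ i, μ i ^ (k + 1) - ∑ i, ν i ^ (k + 1)) / n ^ (k + 1) / (k + 1) := by
    intro k
    rw [hf]
    ring
  have htail := (hasSum_nat_add_iff' (m + 1)).2 hs
  have hhead : ∑ k ∈ range (m + 1), f k = f m := by
    rw [Finset.sum_range_succ, Finset.sum_eq_zero, zero_add]
    intro k hk
    rw [Finset.mem_range] at hk
    rw [hf', hlt (k + 1) (by omega) (by omega), sub_self, zero_div, zero_div]
  rw [hhead] at htail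
  have hm : 1 / n ^ (m + 1) / ((m : ℝ) + 1) ≤ f m := by
    rw [hf']
    gcongr
    linarith
  have hq : b / n < 1 := (div_lt_one hn0).2 hbn
  -- In the tail the denominators `k > j` are replaced by `j + 1 = m + 2`, which leaves a geometric
  -- series of ratio `b / n`.
  have hgeo := ((hasSum_geometric_of_lt_one (div_nonneg hb hn0.le) hq).mul_left
    (-(B / ((m : ℝ) + 2) * (b / n) ^ (m + 2))))
  have hle := hasSum_le (fun k => ?_) hgeo htail
  · have hnb : 0 < n - b := by linarith
    have hcalc : -(B / ((m : ℝ) + 2) * (b / n) ^ (m + 2)) * (1 - b / n)⁻¹ =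
        -((B * b ^ (m + 1 + 1)) / (n - b)) / n ^ (m + 1) / ((m : ℝ) + 2) := by
      rw [show 1 - b / n = (n - b) / n by field_simp, div_pow]
      field_simp
      ring
    rw [hcalc] at hle
    have h1 : (B * b ^ (m + 1 + 1)) / (n - b) ≤ 1 := (div_le_one hnb).2 hBn
    have h2 : -1 / n ^ (m + 1) / ((m : ℝ) + 2) ≤
        -((B * b ^ (m + 1 + 1)) / (n - b)) / n ^ (m + 1) / ((m : ℝ) + 2) := by
      gcongr
    -- Strictness comes from here: the tail loses at most `1 / ((j + 1) n^j)`, the head gains `1 /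
    -- (j n^j)`.
    have h3 : 1 / n ^ (m + 1) / ((m : ℝ) + 2) < 1 / n ^ (m + 1) / ((m : ℝ) + 1) := by
      have : 0 < 1 / n ^ (m + 1) := by positivity
      gcongr
      linarith
    have h4 : -1 / n ^ (m + 1) / ((m : ℝ) + 2) = -(1 / n ^ (m + 1) / ((m : ℝ) + 2)) := by ring
    linarith
  · have h1 := hgt (k + (m + 1) + 1) (by omega)
    have hbk : 0 ≤ B * b ^ (k + (m + 1) + 1) := by positivity
    calc -(B / ((m : ℝ) + 2) * (b / n) ^ (m + 2)) * (b / n) ^ k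
        = -(B * b ^ (k + (m + 1) + 1) / n ^ (k + (m + 1) + 1) / ((m : ℝ) + 2)) := by
          rw [div_pow, div_pow]
          field_simp
          ring
      _ ≤ -(B * b ^ (k + (m + 1) + 1) / n ^ (k + (m + 1) + 1) / (((k + (m + 1) : ℕ) : ℝ) + 1)) := by
          refine neg_le_neg (div_le_div_of_nonneg_left (by positivity) (by positivity) ?_)
          push_cast
          have : (0 : ℝ) ≤ k := Nat.cast_nonneg k
          linarith
      _ = -(B * b ^ (k + (m + 1) + 1)) / n ^ (k + (m + 1) + 1) / (((k + (m + 1) : ℕ) : ℝ) + 1) := by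
          ring
      _ ≤ f (k + (m + 1)) := by
          rw [hf']
          gcongr
          linarith

/-- Bernoulli's inequality for `(μ i / a) ^ m`, multiplied by `a ^ m * μ i` and summed. The linear
correction is nonnegative by `h`. -/
theorem pow_mul_sum_le_sum_pow {a : ℝ} (ha : 0 < a) {μ : ι → ℝ} (h0 : ∀ i, 0 ≤ μ i)
    (h : a * ∑ i, μ i ^ 1 ≤ ∑ i, μ i ^ 2) (m : ℕ) :
    a ^ m * ∑ i, μ i ^ 1 ≤ ∑ i, μ i ^ (m + 1) := by
  have h1 : ∀ i, a ^ m * μ i ^ 1 + m * a ^ m / a * (μ i ^ 2 - a * μ i ^ 1) ≤ μ i ^ (m + 1) := by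
    intro i
    have hb := one_add_mul_sub_le_pow (a := μ i / a)
      (by linarith [div_nonneg (h0 i) ha.le]) m
    have := mul_le_mul_of_nonneg_left hb (mul_nonneg (pow_nonneg ha.le m) (h0 i))
    calc a ^ m * μ i ^ 1 + m * a ^ m / a * (μ i ^ 2 - a * μ i ^ 1)
        = a ^ m * μ i * (1 + m * (μ i / a - 1)) := by
          field_simp
      _ ≤ a ^ m * μ i * (μ i / a) ^ m := this
      _ = μ i ^ (m + 1) := by
          rw [div_pow]
          field_simp
          ring
  have h2 := Finset.sum_le_sum fun i (_ : i ∈ univ) => h1 i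
  rw [Finset.sum_add_distrib, ← Finset.mul_sum, ← Finset.mul_sum, Finset.sum_sub_distrib,
    ← Finset.mul_sum] at h2
  have h3 : 0 ≤ m * a ^ m / a * (∑ i, μ i ^ 2 - a * ∑ i, μ i ^ 1) :=
    mul_nonneg (by positivity) (by linarith)
  linarith

end PowerSums

/-! ### Laplacian spectrum and spanning trees of the complement -/

section Spectrum

variable {V : Type*} [Fintype V]

open Classical in
/-- The Laplacian eigenvalues of `G`. -/
noncomputable def lapEig (G : SimpleGraph V) : V → ℝ :=
  (G.isHermitian_lapMatrix ℝ).eigenvalues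

theorem lapSeq_eq_sum (G : SimpleGraph V) (k : ℕ) : lapSeq G k = ∑ i, lapEig G i ^ k := by
  classical
  unfold lapSeq lapEig
  conv_lhs => rw [(G.isHermitian_lapMatrix ℝ).spectral_theorem]
  rw [← map_pow, Unitary.conjStarAlgAut_apply, Matrix.trace_mul_comm, ← mul_assoc,
    Unitary.coe_star_mul_self, one_mul, Matrix.diagonal_pow, Matrix.trace_diagonal]
  rfl

theorem lapEig_nonneg (G : SimpleGraph V) (i : V) : 0 ≤ lapEig G i := by
  classical
  exact (G.posSemidef_lapMatrix ℝ).eigenvalues_nonneg i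

open Classical in
theorem lapMatrix_add_lapMatrix_compl (G : SimpleGraph V) :
    Matrix.scalar V (Fintype.card V : ℝ) - G.lapMatrix ℝ =
      Gᶜ.lapMatrix ℝ + Matrix.of fun _ _ => (1 : ℝ) := by
  ext v w
  simp only [SimpleGraph.lapMatrix, SimpleGraph.degMatrix, Matrix.sub_apply, Matrix.add_apply,
    Matrix.scalar_apply, Matrix.diagonal_apply, SimpleGraph.adjMatrix_apply, Matrix.of_apply,
    SimpleGraph.compl_adj]
  by_cases hvw : v = w
  · subst hvw
    have h1 : Gᶜ.degree v + G.degree v + 1 = Fintype.card V := by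
      have := G.degree_lt_card_verts v
      rw [SimpleGraph.degree_compl]
      omega
    simp [← h1]
    ring
  · by_cases h : G.Adj v w <;> simp [hvw, h]

theorem prod_card_sub_lapEig [Nonempty V] (G : SimpleGraph V) :
    ∏ i, ((Fintype.card V : ℝ) - lapEig G i) =
      (Fintype.card V : ℝ) ^ 2 * numSpanningTrees Gᶜ := by
  classical
  rw [← det_lapMatrix_add_one, ← lapMatrix_add_lapMatrix_compl, ← Matrix.eval_charpoly,
    (G.isHermitian_lapMatrix ℝ).charpoly_eq, Polynomial.eval_prod]
  simp [lapEig]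

/-- `nI - L(G) = L(Gᶜ) + J` is a sum of two positive semidefinite matrices. -/
theorem lapEig_le_card (G : SimpleGraph V) (i : V) : lapEig G i ≤ Fintype.card V := by
  classical
  have hpsd : (Matrix.scalar V (Fintype.card V : ℝ) - G.lapMatrix ℝ).PosSemidef := by
    rw [lapMatrix_add_lapMatrix_compl]
    refine (Gᶜ.posSemidef_lapMatrix ℝ).add ?_
    have hJ : (Matrix.of fun _ _ : V => (1 : ℝ)) =
        vecMulVec (fun _ => (1 : ℝ)) (star fun _ => (1 : ℝ)) := by
      ext v w
      simp [Matrix.vecMulVec_apply]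
    rw [hJ]
    exact posSemidef_vecMulVec_self_star _
  have hmem := (G.isHermitian_lapMatrix ℝ).eigenvalues_mem_spectrum_real i
  have h := (Matrix.posSemidef_iff_isHermitian_and_spectrum_nonneg.1 hpsd).2
  have h1 : (Fintype.card V : ℝ) - lapEig G i ∈
      spectrum ℝ (Matrix.scalar V (Fintype.card V : ℝ) - G.lapMatrix ℝ) := by
    rw [show Matrix.scalar V (Fintype.card V : ℝ) = algebraMap ℝ _ (Fintype.card V : ℝ) from rfl,
      ← spectrum.singleton_sub_eq]
    exact Set.sub_mem_sub rfl hmem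
  have h2 := h h1
  simpa using h2

end Spectrum

/-! ### The first Laplacian moments and the lower bound for all moments -/

section Degrees

variable {V : Type*} [Fintype V]

open Classical in
theorem sum_degree_eq (G : SimpleGraph V) : ∑ v, G.degree v = 2 * G.edgeSet.ncard := by
  rw [G.sum_degrees_eq_twice_card_edges, ← SimpleGraph.coe_edgeFinset, Set.ncard_coe_finset]

open Classical in
theorem lapSeq_one (G : SimpleGraph V) : lapSeq G 1 = ∑ v, (G.degree v : ℝ) := by
  simp [lapSeq, SimpleGraph.lapMatrix, SimpleGraph.degMatrix, Matrix.trace_sub]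

open Classical in
theorem lapSeq_two (G : SimpleGraph V) :
    lapSeq G 2 = ∑ v, (G.degree v : ℝ) ^ 2 + ∑ v, (G.degree v : ℝ) := by
  rw [lapSeq, pow_two, ← Finset.sum_add_distrib, Matrix.trace]
  refine Finset.sum_congr rfl fun v _ => ?_
  have hA : (G.adjMatrix ℝ * G.adjMatrix ℝ) v v = G.degree v := by
    rw [SimpleGraph.adjMatrix_mul_self_apply_self]
  simp only [SimpleGraph.lapMatrix, SimpleGraph.degMatrix, Matrix.diag_apply, sub_mul, mul_sub,
    Matrix.sub_apply, hA, Matrix.diagonal_mul_diagonal, Matrix.diagonal_apply_eq,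
    Matrix.diagonal_mul, Matrix.mul_diagonal, SimpleGraph.adjMatrix_apply, G.loopless.irrefl]
  simp
  ring

theorem adjSeq_zero (G : SimpleGraph V) : adjSeq G 0 = Fintype.card V := by
  simp [adjSeq, Matrix.trace_one]

theorem lapSeq_zero (G : SimpleGraph V) : lapSeq G 0 = Fintype.card V := by
  simp [lapSeq, Matrix.trace_one]

/-- Integrality makes any strict gap between two moments at least `1`. -/
theorem exists_int_lapSeq (G : SimpleGraph V) (k : ℕ) : ∃ z : ℤ, lapSeq G k = z := by
  classical
  refine ⟨(G.lapMatrix ℤ ^ k).trace, ?_⟩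
  have hmap : G.lapMatrix ℝ = (G.lapMatrix ℤ).map (Int.castRingHom ℝ) := by
    ext v w
    by_cases h : v = w <;> by_cases h' : G.Adj v w <;>
      simp [SimpleGraph.lapMatrix, SimpleGraph.degMatrix, h, h']
  rw [lapSeq, hmap, ← Matrix.map_pow, ← AddMonoidHom.map_trace]
  simp

open Classical in
theorem mem_regularClass {d : ℕ} {G : SimpleGraph V} :
    G ∈ regularClass V d ↔ ∀ v, G.degree v = d := Iff.rfl

variable {d : ℕ} {G H : SimpleGraph V}

theorem lapSeq_one_of_regular (hG : G ∈ regularClass V d) :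
    lapSeq G 1 = Fintype.card V * d := by
  classical
  rw [lapSeq_one]
  simp [mem_regularClass.1 hG]

theorem lapSeq_two_of_regular (hG : G ∈ regularClass V d) :
    lapSeq G 2 = Fintype.card V * d * (d + 1) := by
  classical
  rw [lapSeq_two]
  simp [mem_regularClass.1 hG]
  ring

theorem lapSeq_one_eq_of_ncard_eq (h : H.edgeSet.ncard = G.edgeSet.ncard) :
    lapSeq H 1 = lapSeq G 1 := by
  classical
  rw [lapSeq_one, lapSeq_one, ← Nat.cast_sum, ← Nat.cast_sum, sum_degree_eq, sum_degree_eq, h]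

open Classical in
theorem lapSeq_two_sub (hG : G ∈ regularClass V d) (h : H.edgeSet.ncard = G.edgeSet.ncard) :
    lapSeq H 2 - lapSeq G 2 = ∑ v, ((H.degree v : ℝ) - d) ^ 2 := by
  have h1 : ∑ v, (H.degree v : ℝ) = Fintype.card V * d := by
    rw [← lapSeq_one, lapSeq_one_eq_of_ncard_eq h, lapSeq_one_of_regular hG]
  simp only [sub_sq, Finset.sum_add_distrib, Finset.sum_sub_distrib, ← Finset.sum_mul,
    ← Finset.mul_sum]
  rw [lapSeq_two_of_regular hG, lapSeq_two, h1]
  simp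
  ring

theorem lapSeq_two_le (hG : G ∈ regularClass V d) (h : H.edgeSet.ncard = G.edgeSet.ncard) :
    lapSeq G 2 ≤ lapSeq H 2 := by
  classical
  rw [← sub_nonneg, lapSeq_two_sub hG h]
  positivity

theorem regular_of_lapSeq_two_eq (hG : G ∈ regularClass V d)
    (h : H.edgeSet.ncard = G.edgeSet.ncard) (h2 : lapSeq H 2 = lapSeq G 2) :
    H ∈ regularClass V d := by
  classical
  have h3 := lapSeq_two_sub hG h
  rw [h2, sub_self] at h3
  refine mem_regularClass.2 fun v => ?_
  have := (Finset.sum_eq_zero_iff_of_nonneg fun v _ => sq_nonneg ((H.degree v : ℝ) - d)).1 h3.symm v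
    (mem_univ v)
  have h4 := pow_eq_zero_iff (two_ne_zero) |>.1 this
  exact_mod_cast sub_eq_zero.1 h4

/-- Since `ℓ_1(H) = nd` and `ℓ_2(H) ≥ nd(d+1)`, the power-sum inequality applies with `a = d + 1`. A
disjoint union of copies of `K_{d+1}` attains the bound. -/
theorem le_lapSeq_succ (hG : G ∈ regularClass V d) (h : H.edgeSet.ncard = G.edgeSet.ncard)
    (m : ℕ) : Fintype.card V * d * ((d : ℝ) + 1) ^ m ≤ lapSeq H (m + 1) := by
  have h2 := lapSeq_two_le hG h
  have h1 := lapSeq_one_eq_of_ncard_eq h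
  rw [lapSeq_one_of_regular hG] at h1
  rw [lapSeq_two_of_regular hG] at h2
  have key := pow_mul_sum_le_sum_pow (a := (d : ℝ) + 1) (by positivity) (lapEig_nonneg H)
    (by rw [← lapSeq_eq_sum, ← lapSeq_eq_sum, h1]; linarith) m
  rw [← lapSeq_eq_sum, ← lapSeq_eq_sum, h1] at key
  linarith

end Degrees

/-! ### Upper bounds for the moments and the comparison of tree numbers -/

section UpperBound

variable {V : Type*} [Fintype V] {d : ℕ} {G : SimpleGraph V}

open Classical in
theorem sum_abs_lapMatrix (hG : G ∈ regularClass V d) (v : V) :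
    ∑ w, |G.lapMatrix ℝ v w| = 2 * d := by
  have h : ∀ w, |G.lapMatrix ℝ v w| = (if v = w then (d : ℝ) else 0) + if G.Adj v w then 1 else 0 := by
    intro w
    by_cases hvw : v = w
    · subst hvw
      simp [SimpleGraph.lapMatrix, SimpleGraph.degMatrix, mem_regularClass.1 hG]
    · by_cases h : G.Adj v w <;>
        simp [SimpleGraph.lapMatrix, SimpleGraph.degMatrix, hvw, h]
  simp_rw [h, Finset.sum_add_distrib]
  rw [← SimpleGraph.degree_eq_sum_if_adj, mem_regularClass.1 hG]
  simp
  ring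

open Classical in
theorem sum_abs_lapMatrix_pow (hG : G ∈ regularClass V d) (k : ℕ) (v : V) :
    ∑ w, |(G.lapMatrix ℝ ^ k) v w| ≤ (2 * d) ^ k := by
  induction k generalizing v with
  | zero => simp [Matrix.one_apply, apply_ite abs]
  | succ k ih =>
    rw [pow_succ']
    calc ∑ w, |(G.lapMatrix ℝ * G.lapMatrix ℝ ^ k) v w|
        ≤ ∑ w, ∑ u, |G.lapMatrix ℝ v u| * |(G.lapMatrix ℝ ^ k) u w| := by
          refine Finset.sum_le_sum fun w _ => ?_
          rw [Matrix.mul_apply]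
          refine (Finset.abs_sum_le_sum_abs _ _).trans_eq ?_
          simp_rw [abs_mul]
      _ = ∑ u, |G.lapMatrix ℝ v u| * ∑ w, |(G.lapMatrix ℝ ^ k) u w| := by
          rw [Finset.sum_comm]
          simp_rw [Finset.mul_sum]
      _ ≤ ∑ u, |G.lapMatrix ℝ v u| * (2 * d) ^ k :=
          Finset.sum_le_sum fun u _ => mul_le_mul_of_nonneg_left (ih u) (abs_nonneg _)
      _ = (2 * d) ^ (k + 1) := by
          rw [← Finset.sum_mul, sum_abs_lapMatrix hG, pow_succ']

/-- The vertex `v` has the same closed neighbourhood as each of its neighbours, that is, its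
component is complete. -/
def InCompleteComponent (G : SimpleGraph V) (v : V) : Prop :=
  ∀ w, G.Adj v w → ∀ x, (x = v ∨ G.Adj v x) ↔ (x = w ∨ G.Adj w x)

-- `L e_v` is `(d+1) e_v` minus the indicator of the component of `v`, and that indicator lies in
-- the kernel of `L`.
open Classical in
theorem lapMatrix_sq_mulVec_single (hG : G ∈ regularClass V d) {v : V}
    (hv : InCompleteComponent G v) :
    G.lapMatrix ℝ *ᵥ (G.lapMatrix ℝ *ᵥ Pi.single v 1) =
      ((d : ℝ) + 1) • (G.lapMatrix ℝ *ᵥ Pi.single v 1) := by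
  have h1 : G.lapMatrix ℝ *ᵥ Pi.single v 1 =
      ((d : ℝ) + 1) • Pi.single v 1 - fun x => if x = v ∨ G.Adj v x then 1 else 0 := by
    ext x
    rw [Matrix.mulVec_single_one]
    by_cases hx : x = v
    · subst hx
      simp [SimpleGraph.lapMatrix, SimpleGraph.degMatrix, mem_regularClass.1 hG]
    · simp [SimpleGraph.lapMatrix, SimpleGraph.degMatrix, hx, G.adj_comm x v]
  have h2 : G.lapMatrix ℝ *ᵥ (fun x => if x = v ∨ G.Adj v x then 1 else 0) = 0 := by
    rw [SimpleGraph.lapMatrix_mulVec_eq_zero_iff_forall_adj]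
    intro x y hxy
    have key : ∀ x y, G.Adj x y → (x = v ∨ G.Adj v x) → (y = v ∨ G.Adj v y) := by
      rintro x y hxy (rfl | hx)
      · exact Or.inr hxy
      · exact (hv x hx y).2 (Or.inr hxy)
    simp only [show (x = v ∨ G.Adj v x) ↔ (y = v ∨ G.Adj v y) from
      ⟨key x y hxy, key y x hxy.symm⟩]
  conv_lhs => rw [h1, Matrix.mulVec_sub, h2, sub_zero, Matrix.mulVec_smul]

open Classical in
theorem lapMatrix_pow_mulVec_single (hG : G ∈ regularClass V d) {v : V}
    (hv : InCompleteComponent G v) (m : ℕ) :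
    G.lapMatrix ℝ ^ (m + 1) *ᵥ Pi.single v 1 =
      ((d : ℝ) + 1) ^ m • (G.lapMatrix ℝ *ᵥ Pi.single v 1) := by
  induction m with
  | zero => simp
  | succ m ih =>
    rw [pow_succ', ← Matrix.mulVec_mulVec, ih, Matrix.mulVec_smul,
      lapMatrix_sq_mulVec_single hG hv, smul_smul, pow_succ]

/-- A vertex outside `S` contributes exactly `d(d+1)^m` to the trace; one in `S` is bounded by its
absolute row sum. The main term equals the bound of `le_lapSeq_succ`, so the error depends on `S`
and not on the number of vertices. -/
theorem lapSeq_succ_le (hG : G ∈ regularClass V d) (S : Finset V)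
    (hS : ∀ v, v ∉ S → InCompleteComponent G v) (m : ℕ) :
    lapSeq G (m + 1) ≤ Fintype.card V * d * ((d : ℝ) + 1) ^ m + S.card * (2 * d) ^ (m + 1) := by
  classical
  have hd : ∀ v, (G.lapMatrix ℝ ^ (m + 1)) v v ≤
      d * ((d : ℝ) + 1) ^ m + if v ∈ S then (2 * d : ℝ) ^ (m + 1) else 0 := by
    intro v
    split_ifs with hv
    · have h1 : |(G.lapMatrix ℝ ^ (m + 1)) v v| ≤ ∑ w, |(G.lapMatrix ℝ ^ (m + 1)) v w| :=
        Finset.single_le_sum (f := fun w => |(G.lapMatrix ℝ ^ (m + 1)) v w|)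
        (fun w _ => abs_nonneg _) (mem_univ v)
      have h2 := sum_abs_lapMatrix_pow hG (m + 1) v
      have h3 := le_abs_self ((G.lapMatrix ℝ ^ (m + 1)) v v)
      have h4 : 0 ≤ d * ((d : ℝ) + 1) ^ m := by positivity
      linarith
    · have h1 := congrFun (lapMatrix_pow_mulVec_single hG (hS v hv) m) v
      rw [Matrix.mulVec_single_one, Pi.smul_apply, Matrix.mulVec_single_one] at h1
      have h2 : (G.lapMatrix ℝ).col v v = d := by
        simp [SimpleGraph.lapMatrix, SimpleGraph.degMatrix, mem_regularClass.1 hG]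
      rw [h2, Matrix.col_apply] at h1
      rw [h1, smul_eq_mul, add_zero, mul_comm]
  calc lapSeq G (m + 1) ≤ ∑ v, (d * ((d : ℝ) + 1) ^ m + if v ∈ S then (2 * d : ℝ) ^ (m + 1) else 0) :=
        Finset.sum_le_sum fun v _ => hd v
    _ = _ := by
        rw [Finset.sum_add_distrib]
        simp
        ring

/-- `nI - L` is strictly diagonally dominant, as `n - d > d`, hence nonsingular. -/
theorem numSpanningTrees_compl_pos [Nonempty V] (hG : G ∈ regularClass V d)
    (hn : 2 * d < Fintype.card V) : 0 < numSpanningTrees Gᶜ := by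
  classical
  have hdet : (Matrix.scalar V (Fintype.card V : ℝ) - G.lapMatrix ℝ).det ≠ 0 := by
    refine det_ne_zero_of_sum_row_lt_diag fun v => ?_
    have hv : G.lapMatrix ℝ v v = d := by
      simp [SimpleGraph.lapMatrix, SimpleGraph.degMatrix, mem_regularClass.1 hG]
    have h1 := sum_abs_lapMatrix hG v
    rw [← Finset.sum_erase_add _ _ (mem_univ v), hv, Nat.abs_cast] at h1
    have h2 : ∑ w ∈ univ.erase v, ‖(Matrix.scalar V (Fintype.card V : ℝ) - G.lapMatrix ℝ) v w‖ =
        ∑ w ∈ univ.erase v, |G.lapMatrix ℝ v w| := by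
      refine Finset.sum_congr rfl fun w hw => ?_
      rw [Matrix.sub_apply, Matrix.scalar_apply,
        Matrix.diagonal_apply_ne _ (Finset.ne_of_mem_erase hw).symm, zero_sub, norm_neg,
        Real.norm_eq_abs]
    have h3 : (2 * d : ℝ) < Fintype.card V := by exact_mod_cast hn
    rw [h2, Matrix.sub_apply, Matrix.scalar_apply, Matrix.diagonal_apply_eq, hv, Real.norm_eq_abs]
    refine lt_of_lt_of_le ?_ (le_abs_self _)
    linarith
  rw [← Matrix.eval_charpoly, (G.isHermitian_lapMatrix ℝ).charpoly_eq, Polynomial.eval_prod] at hdet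
  have h := prod_card_sub_lapEig G
  refine Nat.pos_of_ne_zero fun h0 => hdet ?_
  rw [h0, Nat.cast_zero, mul_zero] at h
  rw [← h]
  simp [lapEig]

theorem lapEig_lt_card_of_numSpanningTrees_pos [Nonempty V] (h : 0 < numSpanningTrees Gᶜ) (i : V) :
    lapEig G i < Fintype.card V := by
  refine lt_of_le_of_ne (lapEig_le_card G i) fun hi => ?_
  have h1 := prod_card_sub_lapEig G
  rw [Finset.prod_eq_zero (mem_univ i) (by rw [hi, sub_self])] at h1
  have h2 : (0 : ℝ) < (Fintype.card V : ℝ) ^ 2 * numSpanningTrees Gᶜ := by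
    have := Fintype.card_pos (α := V)
    positivity
  linarith

/-- If the Laplacian sequences of the regular graph `G`, almost all of whose components are
complete, and of `H` first differ at `j`, where that of `H` is larger, then the complement of `H`
has fewer spanning trees as soon as there are enough vertices. -/
theorem numSpanningTrees_compl_lt [Nonempty V] {H : SimpleGraph V} (hG : G ∈ regularClass V d)
    (S : Finset V) (hS : ∀ v, v ∉ S → InCompleteComponent G v)
    (h : H.edgeSet.ncard = G.edgeSet.ncard) {j : ℕ} (hj : 1 ≤ j)
    (hlt : ∀ i, 1 ≤ i → i < j → lapSeq H i = lapSeq G i) (heq : lapSeq G j < lapSeq H j)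
    (hn : 2 * d < Fintype.card V) (hcard : 2 * d + S.card * (2 * d) ^ (j + 1) ≤ Fintype.card V) :
    numSpanningTrees Hᶜ < numSpanningTrees Gᶜ := by
  have hGpos := numSpanningTrees_compl_pos hG hn
  -- If `t(Hᶜ) = 0` there is nothing left; otherwise all eigenvalues of `H` are below `n` and the
  -- logarithmic series converges.
  rcases Nat.eq_zero_or_pos (numSpanningTrees Hᶜ) with h0 | hHpos
  · rwa [h0]
  have hnR : (2 * d : ℝ) < Fintype.card V := by exact_mod_cast hn
  have hint : lapSeq G j + 1 ≤ lapSeq H j := by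
    obtain ⟨a, ha⟩ := exists_int_lapSeq G j
    obtain ⟨b, hb⟩ := exists_int_lapSeq H j
    rw [ha, hb] at heq ⊢
    exact_mod_cast heq
  have hcardR : (2 * d : ℝ) + S.card * (2 * d) ^ (j + 1) ≤ Fintype.card V := by exact_mod_cast hcard
  have hprod := prod_sub_lt_prod_sub (n := Fintype.card V) (b := 2 * d) (B := S.card) (j := j)
    (by exact_mod_cast Fintype.card_pos) (lapEig_nonneg H)
    (lapEig_lt_card_of_numSpanningTrees_pos hHpos) (lapEig_nonneg G)
    (lapEig_lt_card_of_numSpanningTrees_pos hGpos) hj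
    (fun k h1 h2 => by rw [← lapSeq_eq_sum, ← lapSeq_eq_sum, hlt k h1 h2])
    (by rwa [← lapSeq_eq_sum, ← lapSeq_eq_sum])
    (fun k hk => by
      obtain ⟨m, rfl⟩ : ∃ m, k = m + 1 := ⟨k - 1, by omega⟩
      rw [← lapSeq_eq_sum, ← lapSeq_eq_sum]
      linarith [lapSeq_succ_le hG S hS m, le_lapSeq_succ hG h m])
    (by positivity) (by positivity) hnR (by linarith)
  rw [prod_card_sub_lapEig, prod_card_sub_lapEig] at hprod
  exact_mod_cast lt_of_mul_lt_mul_left hprod (by positivity)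

end UpperBound

/-! ### From trace-minimality of the complement to the Laplacian sequence -/

section Complement

variable {V : Type*} [Fintype V] {d : ℕ} {G H : SimpleGraph V}

open Classical in
theorem compl_mem_regularClass (hG : G ∈ regularClass V d) :
    Gᶜ ∈ regularClass V (Fintype.card V - 1 - d) := by
  refine mem_regularClass.2 fun v => ?_
  rw [SimpleGraph.degree_compl, mem_regularClass.1 hG]

open Classical in
theorem lapMatrix_add_one_pow (i : ℕ) :
    (G.lapMatrix ℝ + Matrix.of fun _ _ => (1 : ℝ)) ^ (i + 1) =
      G.lapMatrix ℝ ^ (i + 1) + (Fintype.card V : ℝ) ^ i • Matrix.of fun _ _ => (1 : ℝ) := by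
  set J : Matrix V V ℝ := Matrix.of fun _ _ => (1 : ℝ) with hJ
  have h1 : G.lapMatrix ℝ * J = 0 := by
    ext v w
    simp [Matrix.mul_apply, hJ, lapMatrix_row_sum]
  have h2 : J * G.lapMatrix ℝ = 0 := by
    ext v w
    simp [Matrix.mul_apply, hJ, lapMatrix_col_sum]
  have h3 : J * J = (Fintype.card V : ℝ) • J := by
    ext v w
    simp [Matrix.mul_apply, hJ]
  induction i with
  | zero => simp
  | succ i ih =>
    have h4 : G.lapMatrix ℝ ^ (i + 1) * J = 0 := by
      rw [pow_succ, Matrix.mul_assoc, h1, Matrix.mul_zero]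
    rw [pow_succ, ih, add_mul, mul_add, mul_add, h4, Matrix.smul_mul, Matrix.smul_mul, h2, h3,
      smul_zero, add_zero, zero_add, smul_smul, ← pow_succ, ← pow_succ]

/-- The Laplacian sequence of a regular graph in terms of the adjacency sequence of its
complement. -/
theorem lapSeq_succ_add_eq (hG : G ∈ regularClass V d) (i : ℕ) :
    lapSeq G (i + 1) + (Fintype.card V : ℝ) ^ (i + 1) =
      ∑ l ∈ range (i + 1 + 1),
        adjSeq Gᶜ l * (((d : ℝ) + 1) ^ (i + 1 - l) * (i + 1).choose l) := by
  classical
  have hX : G.lapMatrix ℝ + (Matrix.of fun _ _ => (1 : ℝ)) =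
      Gᶜ.adjMatrix ℝ + Matrix.scalar V ((d : ℝ) + 1) := by
    ext v w
    by_cases hvw : v = w
    · subst hvw
      simp [SimpleGraph.lapMatrix, SimpleGraph.degMatrix, mem_regularClass.1 hG]
    · by_cases h : G.Adj v w <;>
        simp [SimpleGraph.lapMatrix, SimpleGraph.degMatrix, hvw, h]
  have h1 := congrArg Matrix.trace (lapMatrix_add_one_pow (G := G) i)
  have hc : Commute (Gᶜ.adjMatrix ℝ) (Matrix.scalar V ((d : ℝ) + 1)) :=
    (Matrix.scalar_commute _ (fun r => Commute.all _ _) _).symm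
  rw [hX, hc.add_pow, Matrix.trace_sum, Matrix.trace_add, Matrix.trace_smul] at h1
  have hJ : (Matrix.of fun _ _ : V => (1 : ℝ)).trace = Fintype.card V := by
    simp [Matrix.trace]
  rw [hJ, smul_eq_mul, ← pow_succ] at h1
  rw [lapSeq, ← h1]
  refine Finset.sum_congr rfl fun l _ => ?_
  have h2 : Gᶜ.adjMatrix ℝ ^ l * Matrix.scalar V ((d : ℝ) + 1) ^ (i + 1 - l) *
      ((i + 1).choose l : Matrix V V ℝ) =
      ((((d : ℝ) + 1) ^ (i + 1 - l) * (i + 1).choose l : ℝ)) • Gᶜ.adjMatrix ℝ ^ l := by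
    rw [← map_pow, ← map_natCast (Matrix.scalar V), mul_assoc, ← map_mul]
    ext v w
    simp [Matrix.scalar_apply, Matrix.mul_diagonal]
    ring
  rw [h2, Matrix.trace_smul, smul_eq_mul, adjSeq, mul_comm]
  congr!

/-- The expansion of `ℓ_j` in the adjacency traces of the complement is triangular with leading
coefficient `1`, and the lower terms cancel. -/
theorem lapSeq_sub_lapSeq_of_adjSeq_eq (hG : G ∈ regularClass V d) (hH : H ∈ regularClass V d)
    {j : ℕ} (hj : 1 ≤ j) (h : ∀ i, 1 ≤ i → i < j → adjSeq Gᶜ i = adjSeq Hᶜ i) :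
    lapSeq H j - lapSeq G j = adjSeq Hᶜ j - adjSeq Gᶜ j := by
  obtain ⟨m, rfl⟩ : ∃ m, j = m + 1 := ⟨j - 1, by omega⟩
  have h1 := lapSeq_succ_add_eq hG m
  have h2 := lapSeq_succ_add_eq hH m
  have h3 : ∑ l ∈ range (m + 1), adjSeq Gᶜ l * (((d : ℝ) + 1) ^ (m + 1 - l) * (m + 1).choose l) =
      ∑ l ∈ range (m + 1), adjSeq Hᶜ l * (((d : ℝ) + 1) ^ (m + 1 - l) * (m + 1).choose l) := by
    refine Finset.sum_congr rfl fun l hl => ?_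
    rw [Finset.mem_range] at hl
    rcases Nat.eq_zero_or_pos l with rfl | hl0
    · rw [adjSeq_zero, adjSeq_zero]
    · rw [h l hl0 hl]
  rw [Finset.sum_range_succ] at h1 h2
  simp only [Nat.sub_self, pow_zero, Nat.choose_self, Nat.cast_one, mul_one] at h1 h2
  linarith

/-- The sequences `b` and `c` first differ at the index `j`, where `c` is larger. -/
def FirstDiff (b c : ℕ → ℝ) (j : ℕ) : Prop :=
  1 ≤ j ∧ (∀ i, 1 ≤ i → i < j → b i = c i) ∧ b j < c j

/-- The index supplied by `SeqLE` may be preceded by strict inequalities, so the least index of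
disagreement is taken. -/
theorem SeqLE.exists_firstDiff {b c : ℕ → ℝ} (h : SeqLE b c) (hne : ¬ ∀ i, 1 ≤ i → b i = c i) :
    ∃ j, FirstDiff b c j := by
  classical
  obtain ⟨j, hj, hle, hlt⟩ := h.resolve_left hne
  have hex : ∃ j, 1 ≤ j ∧ b j ≠ c j := ⟨j, hj, hlt.ne⟩
  obtain ⟨h1, h2⟩ := Nat.find_spec hex
  refine ⟨Nat.find hex, h1, fun i hi hij => ?_, ?_⟩
  · by_contra h'
    exact Nat.find_min hex hij ⟨hi, h'⟩
  · rcases (Nat.find_min' hex ⟨hj, hlt.ne⟩).lt_or_eq with h' | h'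
    · exact lt_of_le_of_ne (hle _ h1 h') h2
    · rwa [h']

theorem IsTraceMinimal.congr {k : ℕ} (hG : IsTraceMinimal k G) (hH : H ∈ regularClass V k)
    (h : ∀ i, 1 ≤ i → adjSeq G i = adjSeq H i) : IsTraceMinimal k H := by
  refine ⟨hH, fun K hK => ?_⟩
  rcases hG.2 K hK with h1 | ⟨j, h1, h2, h3⟩
  · exact Or.inl fun i hi => (h i hi).symm.trans (h1 i hi)
  · exact Or.inr ⟨j, h1, fun i hi hij => h i hi ▸ h2 i hi hij, h j h1 ▸ h3⟩

omit [Fintype V] in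
theorem nonempty_iso_of_compl (h : Nonempty (Hᶜ ≃g Gᶜ)) : Nonempty (H ≃g G) := by
  obtain ⟨e⟩ := h
  refine ⟨⟨e.toEquiv, fun {v w} => ?_⟩⟩
  have h1 := e.map_rel_iff' (a := v) (b := w)
  simp only [SimpleGraph.compl_adj, ne_eq, e.toEquiv.injective.eq_iff] at h1
  by_cases hvw : v = w
  · subst hvw
    simp
  · simpa [hvw, not_iff_not] using h1

/-- A nonregular `H` has the same `ℓ_1` but a larger `ℓ_2`. The alternative `j = 2` is recorded
because `firstDiff_le` needs `H` regular. -/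
theorem adjSeq_compl_eq_or_exists_firstDiff (hG : G ∈ regularClass V d)
    (hmin : IsTraceMinimal (Fintype.card V - 1 - d) Gᶜ)
    (h : H.edgeSet.ncard = G.edgeSet.ncard) :
    (H ∈ regularClass V d ∧ ∀ i, 1 ≤ i → adjSeq Gᶜ i = adjSeq Hᶜ i) ∨
      ∃ j, FirstDiff (lapSeq G) (lapSeq H) j ∧ (H ∈ regularClass V d ∨ j = 2) := by
  by_cases hH : H ∈ regularClass V d
  · by_cases heq : ∀ i, 1 ≤ i → adjSeq Gᶜ i = adjSeq Hᶜ i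
    · exact Or.inl ⟨hH, heq⟩
    obtain ⟨j, hj, h1, h2⟩ := (hmin.2 Hᶜ (compl_mem_regularClass hH)).exists_firstDiff heq
    refine Or.inr ⟨j, ⟨hj, fun i hi hij => ?_, ?_⟩, Or.inl hH⟩
    · have := lapSeq_sub_lapSeq_of_adjSeq_eq hG hH hi fun l hl hli => h1 l hl (hli.trans hij)
      rw [h1 i hi hij] at this
      linarith
    · have := lapSeq_sub_lapSeq_of_adjSeq_eq hG hH hj h1
      linarith
  · refine Or.inr ⟨2, ⟨one_le_two, fun i hi hi2 => ?_, ?_⟩, Or.inr rfl⟩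
    · obtain rfl : i = 1 := by omega
      exact (lapSeq_one_eq_of_ncard_eq h).symm
    · exact lt_of_le_of_ne (lapSeq_two_le hG h) fun h2 => hH (regular_of_lapSeq_two_eq hG h h2.symm)

theorem lapSeq_eq_or_exists_firstDiff (hG : G ∈ regularClass V d)
    (hmin : IsTraceMinimal (Fintype.card V - 1 - d) Gᶜ)
    (h : H.edgeSet.ncard = G.edgeSet.ncard) :
    (∀ i, 1 ≤ i → lapSeq G i = lapSeq H i) ∨ ∃ j, FirstDiff (lapSeq G) (lapSeq H) j := by
  rcases adjSeq_compl_eq_or_exists_firstDiff hG hmin h with ⟨hH, heq⟩ | ⟨j, hj, -⟩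
  · refine Or.inl fun i hi => ?_
    have := lapSeq_sub_lapSeq_of_adjSeq_eq hG hH hi fun l hl _ => heq l hl
    rw [heq i hi] at this
    linarith
  · exact Or.inr ⟨j, hj⟩

theorem exists_firstDiff_lapSeq (hG : G ∈ regularClass V d)
    (hmin : IsOnlyTraceMinimal (Fintype.card V - 1 - d) Gᶜ)
    (h : H.edgeSet.ncard = G.edgeSet.ncard) (hiso : ¬ Nonempty (H ≃g G)) :
    ∃ j, FirstDiff (lapSeq G) (lapSeq H) j ∧ (H ∈ regularClass V d ∨ j = 2) := by
  refine (adjSeq_compl_eq_or_exists_firstDiff hG hmin.1 h).resolve_left fun ⟨hH, heq⟩ => hiso ?_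
  exact nonempty_iso_of_compl (hmin.2 Hᶜ (hmin.1.congr (compl_mem_regularClass hH) heq))

theorem lapClass_subset_edgeClass (m k : ℕ) : lapClass V m k ⊆ edgeClass V m := by
  induction k with
  | zero => exact subset_rfl
  | succ k ih =>
    cases k with
    | zero => exact subset_rfl
    | succ k => exact fun G hG => ih hG.1

/-- If `G` is strictly minimal in the lexicographic order of the Laplacian sequences, then the
members of `lapClass V m k` agree with `G` up to the index `k`, and `G` is one of them. -/
theorem mem_lapClass_of_firstDiff
    (hfd : ∀ K ∈ edgeClass V G.edgeSet.ncard, (∀ i, 1 ≤ i → lapSeq G i = lapSeq K i) ∨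
      ∃ j, FirstDiff (lapSeq G) (lapSeq K) j) (k : ℕ) :
    G ∈ lapClass V G.edgeSet.ncard (k + 1) ∧ ∀ K ∈ edgeClass V G.edgeSet.ncard,
      (K ∈ lapClass V G.edgeSet.ncard (k + 1) ↔
        ∀ i, 1 ≤ i → i ≤ k + 1 → lapSeq G i = lapSeq K i) := by
  induction k with
  | zero =>
    refine ⟨rfl, fun K hK => ⟨fun _ i hi hi1 => ?_, fun _ => hK⟩⟩
    obtain rfl : i = 1 := by omega
    exact (lapSeq_one_eq_of_ncard_eq hK).symm
  | succ k ih =>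
    have hmin : ∀ K ∈ lapClass V G.edgeSet.ncard (k + 1), lapSeq G (k + 2) ≤ lapSeq K (k + 2) := by
      intro K hK
      have hKe := lapClass_subset_edgeClass _ _ hK
      rcases hfd K hKe with h1 | ⟨j, h1, h2, h3⟩
      · exact (h1 _ (by omega)).le
      · have h4 := (ih.2 K hKe).1 hK
        have h5 : k + 1 < j := by
          by_contra h5
          exact h3.ne (h4 j h1 (by omega))
        rcases (show k + 2 ≤ j from h5).lt_or_eq with h6 | h6
        · exact (h2 _ (by omega) h6).le
        · rw [h6]
          exact h3.le
    have hG : G ∈ lapClass V G.edgeSet.ncard (k + 2) := ⟨ih.1, hmin⟩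
    refine ⟨hG, fun K hK => ⟨fun hKm i hi hik => ?_, fun hKs => ⟨?_, fun F hF => ?_⟩⟩⟩
    · rcases hik.lt_or_eq with h | rfl
      · exact (ih.2 K hK).1 hKm.1 i hi (by omega)
      · exact le_antisymm (hmin K hKm.1) (hKm.2 G ih.1)
    · exact (ih.2 K hK).2 fun i hi hik => hKs i hi (by omega)
    · rw [← hKs (k + 2) (by omega) le_rfl]
      exact hmin F hF

end Complement

/-! ### A bound for the first difference, from few nontrivial eigenvalues -/

section Recurrence

open Polynomial

/-- Power sums over roots of a monic polynomial that agree below its degree agree everywhere. -/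
theorem sum_pow_eq_of_roots {ι : Type*} [Fintype ι] {P : ℝ[X]} (hP : P.Monic) {μ ν : ι → ℝ}
    (hμ : ∀ i, P.eval (μ i) = 0) (hν : ∀ i, P.eval (ν i) = 0)
    (h : ∀ k, k < P.natDegree → ∑ i, μ i ^ k = ∑ i, ν i ^ k) (k : ℕ) :
    ∑ i, μ i ^ k = ∑ i, ν i ^ k := by
  -- Reducing `X ^ k` modulo `P` expresses the `k`-th power sum through the lower ones, with
  -- coefficients independent of the roots.
  have key : ∀ x : ι → ℝ, (∀ i, P.eval (x i) = 0) →
      ∑ i, x i ^ k = ∑ l ∈ range P.natDegree, (X ^ k %ₘ P : ℝ[X]).coeff l * ∑ i, x i ^ l := by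
    intro x hx
    simp_rw [Finset.mul_sum]
    rw [Finset.sum_comm]
    refine Finset.sum_congr rfl fun i _ => ?_
    by_cases hP1 : P = 1
    · have := hx i
      rw [hP1, eval_one] at this
      exact absurd this one_ne_zero
    rw [← eval_eq_sum_range' (natDegree_modByMonic_lt _ hP hP1)]
    have h1 := congrArg (eval (x i)) (modByMonic_add_div (X ^ k) P)
    rw [eval_add, eval_mul, hx i, zero_mul, add_zero, eval_pow, eval_X] at h1
    exact h1.symm
  rw [key μ hμ, key ν hν]
  exact Finset.sum_congr rfl fun l hl => by rw [h l (Finset.mem_range.1 hl)]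

variable {V : Type*} [Fintype V] {d : ℕ} {G H : SimpleGraph V}

/-- The Laplacian eigenvalues other than `0` and `d + 1` of a `d`-regular graph are few if its
third Laplacian moment is close to the least possible one. -/
theorem card_nontrivial_lapEig_le (hG : G ∈ regularClass V d) {C : ℕ}
    (h3 : lapSeq G 3 ≤ Fintype.card V * d * ((d : ℝ) + 1) ^ 2 + C) :
    #{i | lapEig G i * (lapEig G i - (d + 1)) ≠ 0} ≤ C := by
  classical
  set L := G.lapMatrix ℝ with hL
  set N := L - Matrix.scalar V ((d : ℝ) + 1) with hN
  have hLH : L.IsHermitian := G.isHermitian_lapMatrix ℝ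
  -- In an eigenbasis `L * N` is diagonal with entries `λ(λ - (d+1))`, so its rank is the number to
  -- be bounded.
  have hrank : (L * N).rank = #{i | lapEig G i * (lapEig G i - (d + 1)) ≠ 0} := by
    have hdiag : L * N = Unitary.conjStarAlgAut ℝ _ hLH.eigenvectorUnitary
        (diagonal fun i => lapEig G i * (lapEig G i - (d + 1))) := by
      have h1 : L * N = L ^ 2 - ((d : ℝ) + 1) • L := by
        rw [hN, mul_sub, pow_two]
        congr 1
        ext v w
        simp [Matrix.mul_diagonal, mul_comm]
      have h2 : (diagonal fun i => lapEig G i * (lapEig G i - (d + 1))) =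
          (diagonal (RCLike.ofReal ∘ hLH.eigenvalues) : Matrix V V ℝ) ^ 2 -
            ((d : ℝ) + 1) • (diagonal (RCLike.ofReal ∘ hLH.eigenvalues) : Matrix V V ℝ) := by
        ext v w
        by_cases hvw : v = w
        · subst hvw
          simp [Matrix.diagonal_pow, lapEig]
          ring
        · simp [Matrix.diagonal_pow, hvw]
      rw [h1, h2, map_sub, map_pow, map_smul, ← hLH.spectral_theorem]
    rw [hdiag, Unitary.conjStarAlgAut_apply, Matrix.rank_mul_eq_left_of_isUnit_det,
      Matrix.rank_mul_eq_right_of_isUnit_det, Matrix.rank_diagonal, Fintype.card_subtype]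
    · exact (Matrix.isUnit_iff_isUnit_det _).1 (Unitary.isUnit_coe)
    · exact (Matrix.isUnit_iff_isUnit_det _).1 (Unitary.isUnit_coe (U := star hLH.eigenvectorUnitary))
  set S : Finset V := {v | (L * N).col v ≠ 0} with hS
  have hrankle : (L * N).rank ≤ #S := by
    have h1 : L * N = L * N * diagonal fun v => if v ∈ S then 1 else 0 := by
      ext v w
      rw [Matrix.mul_diagonal]
      split_ifs with hw
      · rw [mul_one]
      · have : (L * N).col w = 0 := by simpa [hS] using hw
        rw [mul_zero]
        exact congrFun this v
    rw [h1]
    refine (Matrix.rank_mul_le_right _ _).trans ?_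
    rw [Matrix.rank_diagonal, Fintype.card_subtype]
    exact Finset.card_le_card fun v hv => by simpa using hv
  have hNH : Nᴴ = N := by
    rw [hN, Matrix.conjTranspose_sub, hLH.eq]
    simp [Matrix.scalar_apply]
  have hpsd : (N * L * N).PosSemidef := by
    have := (G.posSemidef_lapMatrix ℝ).conjTranspose_mul_mul_same N
    rwa [hNH] at this
  have hint : ∀ v, ∃ z : ℤ, (N * L * N) v v = z := by
    intro v
    have hmapL : L = (G.lapMatrix ℤ).map (Int.castRingHom ℝ) := by
      ext v w
      by_cases h : v = w <;> by_cases h' : G.Adj v w <;>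
        simp [hL, SimpleGraph.lapMatrix, SimpleGraph.degMatrix, h, h']
    have hmapN : N = (G.lapMatrix ℤ - Matrix.scalar V ((d : ℤ) + 1)).map (Int.castRingHom ℝ) := by
      rw [hN, hmapL]
      ext v w
      simp only [Matrix.sub_apply, Matrix.map_apply, Matrix.scalar_apply, Matrix.diagonal_apply,
        map_sub]
      split_ifs <;> simp
    rw [hmapN, hmapL, ← Matrix.map_mul, ← Matrix.map_mul]
    exact ⟨_, rfl⟩
  -- A diagonal entry of the positive semidefinite integral matrix `N * L * N` is a nonnegative
  -- integer, and it vanishes only if `L` kills column `v` of `N`. So the trace bounds the number of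
  -- nonzero columns of `L * N`.
  have hdiag : ∀ v, (if v ∈ S then (1 : ℝ) else 0) ≤ (N * L * N) v v := by
    intro v
    have h0 : 0 ≤ (N * L * N) v v := hpsd.diag_nonneg
    split_ifs with hv
    · obtain ⟨z, hz⟩ := hint v
      rw [hz] at h0 ⊢
      have hz0 : z ≠ 0 := by
        rintro rfl
        have hcol : N.col v ⬝ᵥ (L *ᵥ N.col v) = 0 := by
          have h1 : N.col v ⬝ᵥ (L *ᵥ N.col v) = (Nᵀ * L * N) v v := by
            rw [Matrix.mul_assoc, Matrix.mul_apply, dotProduct]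
            rfl
          rw [h1, ← Matrix.conjTranspose_eq_transpose_of_trivial, hNH, hz, Int.cast_zero]
        have h2 := ((G.posSemidef_lapMatrix ℝ).dotProduct_mulVec_zero_iff (N.col v)).1 hcol
        have h3 : (L * N).col v ≠ 0 := by simpa [hS] using hv
        exact h3 h2
      have : 0 ≤ z := by exact_mod_cast h0
      exact_mod_cast (show 1 ≤ z by omega)
    · exact h0
  have htrace : (N * L * N).trace = lapSeq G 3 - Fintype.card V * d * ((d : ℝ) + 1) ^ 2 := by
    have h1 : N * L * N = L ^ 3 - (2 * ((d : ℝ) + 1)) • L ^ 2 + ((d : ℝ) + 1) ^ 2 • L ^ 1 := by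
      have hsc : Matrix.scalar V ((d : ℝ) + 1) = ((d : ℝ) + 1) • (1 : Matrix V V ℝ) := by
        ext v w
        simp [Matrix.one_apply, Matrix.diagonal_apply]
      rw [hN, hsc]
      simp only [sub_mul, mul_sub, Matrix.smul_mul, Matrix.mul_smul, Matrix.one_mul, Matrix.mul_one,
        smul_smul, pow_succ, pow_zero]
      module
    rw [h1, Matrix.trace_add, Matrix.trace_sub, Matrix.trace_smul, Matrix.trace_smul]
    change lapSeq G 3 - (2 * ((d : ℝ) + 1)) • lapSeq G 2 + ((d : ℝ) + 1) ^ 2 • lapSeq G 1 = _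
    rw [lapSeq_one_of_regular hG, lapSeq_two_of_regular hG]
    simp only [smul_eq_mul]
    ring
  have hS' : (#S : ℝ) ≤ (N * L * N).trace := by
    have := Finset.sum_le_sum fun v (_ : v ∈ univ) => hdiag v
    simpa [Matrix.trace] using this
  rw [← hrank]
  refine hrankle.trans ?_
  have : (#S : ℝ) ≤ C := by linarith
  exact_mod_cast this

theorem exists_monic_eval_lapEig_eq_zero (hG : G ∈ regularClass V d) {B : ℕ}
    (h3 : lapSeq G 3 ≤ Fintype.card V * d * ((d : ℝ) + 1) ^ 2 + B) :
    ∃ P : ℝ[X], P.Monic ∧ P.natDegree ≤ B + 2 ∧ ∀ i, P.eval (lapEig G i) = 0 := by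
  classical
  set T : Finset V := {i | lapEig G i * (lapEig G i - (d + 1)) ≠ 0} with hT
  have hm : (∏ i ∈ T, (X - C (lapEig G i))).Monic :=
    monic_prod_of_monic _ _ fun i _ => monic_X_sub_C _
  have hm' : (X * (X - C ((d : ℝ) + 1))).Monic := monic_X.mul (monic_X_sub_C _)
  refine ⟨X * (X - C ((d : ℝ) + 1)) * ∏ i ∈ T, (X - C (lapEig G i)), hm'.mul hm, ?_, fun i => ?_⟩
  · rw [hm'.natDegree_mul hm, monic_X.natDegree_mul (monic_X_sub_C _), natDegree_X,
      natDegree_X_sub_C, natDegree_prod_of_monic _ _ fun i _ => monic_X_sub_C _]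
    simp only [natDegree_X_sub_C, Finset.sum_const, smul_eq_mul, mul_one]
    have : #T ≤ B := by
      convert card_nontrivial_lapEig_le hG h3
    omega
  · by_cases hi : i ∈ T
    · rw [eval_mul, eval_prod, Finset.prod_eq_zero hi (by simp), mul_zero]
    · have : lapEig G i * (lapEig G i - (d + 1)) = 0 := by
        simpa only [hT, mem_filter, mem_univ, true_and, not_not] using hi
      rw [eval_mul, eval_mul, eval_sub, eval_X, eval_C, this, zero_mul]

/-- A uniform bound on the index where the Laplacian sequences of regular graphs with small third
moment first differ. -/
theorem firstDiff_le (hG : G ∈ regularClass V d) (hH : H ∈ regularClass V d) {C j : ℕ}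
    (h3 : lapSeq G 3 ≤ Fintype.card V * d * ((d : ℝ) + 1) ^ 2 + C)
    (hj : FirstDiff (lapSeq G) (lapSeq H) j) : j ≤ 2 * C + 4 := by
  by_contra hlt
  obtain ⟨h1, h2, h4⟩ := hj
  -- `P * Q` vanishes on both spectra and has degree at most `2(C + 2)`. Agreement below that degree
  -- would force agreement at `j` too. Since `j > 3`, the third moment of `H` satisfies the same
  -- bound.
  obtain ⟨P, hP, hPd, hPG⟩ := exists_monic_eval_lapEig_eq_zero hG h3
  obtain ⟨Q, hQ, hQd, hQH⟩ := exists_monic_eval_lapEig_eq_zero hH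
    (h2 3 (by omega) (by omega) ▸ h3)
  refine h4.ne ?_
  rw [lapSeq_eq_sum, lapSeq_eq_sum]
  refine sum_pow_eq_of_roots (hP.mul hQ) (fun i => ?_) (fun i => ?_) (fun k hk => ?_) j
  · rw [eval_mul, hPG, zero_mul]
  · rw [eval_mul, hQH, mul_zero]
  · rw [hP.natDegree_mul hQ] at hk
    rw [← lapSeq_eq_sum, ← lapSeq_eq_sum]
    rcases Nat.eq_zero_or_pos k with rfl | hk0
    · rw [lapSeq_zero, lapSeq_zero]
    · exact h2 k hk0 (by omega)

end Recurrence

/-! ### Passing between optimality and complements -/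

section Optimality

theorem numSpanningTrees_congr {V W : Type*} {G : SimpleGraph V} {H : SimpleGraph W}
    (e : G ≃g H) : numSpanningTrees G = numSpanningTrees H := by
  unfold numSpanningTrees
  refine Set.ncard_congr (fun T _ => T.map e.toEquiv.toEmbedding) ?_ ?_ ?_
  · rintro T ⟨hle, hT⟩
    refine ⟨?_, (SimpleGraph.Iso.isTree_iff (SimpleGraph.Iso.map e.toEquiv T)).1 hT⟩
    rintro _ _ ⟨-, v, w, hvw, rfl, rfl⟩
    exact e.map_rel_iff.2 (hle hvw)
  · intro T T' _ _ h
    exact SimpleGraph.map_injective e.toEquiv.toEmbedding h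
  · rintro T ⟨hle, hT⟩
    refine ⟨T.comap e.toEquiv.toEmbedding, ⟨?_, ?_⟩, ?_⟩
    · intro v w hvw
      exact e.map_rel_iff.1 (hle hvw)
    · exact (SimpleGraph.Iso.isTree_iff (SimpleGraph.Iso.comap e.toEquiv T)).2 hT
    · ext v w
      constructor
      · rintro ⟨-, v, w, hvw, rfl, rfl⟩
        exact hvw
      · intro hvw
        refine ⟨hvw.ne, e.symm v, e.symm w, ?_, e.apply_symm_apply v, e.apply_symm_apply w⟩
        change T.Adj (e (e.symm v)) (e (e.symm w))
        rwa [e.apply_symm_apply, e.apply_symm_apply]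

variable {V : Type*} [Fintype V] {G H : SimpleGraph V}

theorem ncard_edgeSet_compl_add (G : SimpleGraph V) :
    2 * Gᶜ.edgeSet.ncard + 2 * G.edgeSet.ncard = Fintype.card V * (Fintype.card V - 1) := by
  classical
  rw [← sum_degree_eq, ← sum_degree_eq, ← Finset.sum_add_distrib]
  refine (Finset.sum_congr rfl fun v _ => ?_).trans
    (Finset.sum_const_nat (m := Fintype.card V - 1) fun _ _ => rfl)
  have := G.degree_lt_card_verts v
  rw [SimpleGraph.degree_compl]
  omega

theorem ncard_edgeSet_compl_eq (h : H.edgeSet.ncard = G.edgeSet.ncard) :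
    Hᶜ.edgeSet.ncard = Gᶜ.edgeSet.ncard := by
  have h1 := ncard_edgeSet_compl_add H
  have h2 := ncard_edgeSet_compl_add G
  omega

theorem eq_bot_of_ncard_edgeSet_eq_zero (h : G.edgeSet.ncard = 0) : G = ⊥ := by
  rwa [Set.ncard_eq_zero (Set.toFinite _), SimpleGraph.edgeSet_eq_empty] at h

theorem ncard_edgeSet_eq_zero_of_regular (hG : G ∈ regularClass V 0) : G.edgeSet.ncard = 0 := by
  classical
  have h := sum_degree_eq G
  rw [Finset.sum_eq_zero fun v _ => mem_regularClass.1 hG v] at h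
  omega

theorem isOnlyTOptimal_compl (h : ∀ H : SimpleGraph V, H.edgeSet.ncard = G.edgeSet.ncard →
    ¬ Nonempty (H ≃g G) → numSpanningTrees Hᶜ < numSpanningTrees Gᶜ) : IsOnlyTOptimal Gᶜ := by
  have key : ∀ H ∈ edgeClass V Gᶜ.edgeSet.ncard, ¬ Nonempty (H ≃g Gᶜ) →
      numSpanningTrees H < numSpanningTrees Gᶜ := by
    intro H hH hiso
    have h1 : Hᶜ.edgeSet.ncard = G.edgeSet.ncard := by
      rw [ncard_edgeSet_compl_eq (G := Gᶜ) hH, compl_compl]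
    have h2 := h Hᶜ h1 fun h3 =>
      hiso (nonempty_iso_of_compl (by rwa [compl_compl]))
    rwa [compl_compl] at h2
  refine ⟨fun H hH => ?_, fun H hH hopt => ?_⟩
  · by_cases hiso : Nonempty (H ≃g Gᶜ)
    · exact (numSpanningTrees_congr hiso.some).le
    · exact (key H hH hiso).le
  · by_contra hiso
    exact absurd (hopt Gᶜ (Eq.symm hH)) (not_le.2 (key H hH hiso))

end Optimality

/-! ### The graphs with added complete components -/

section AddCompletes

variable {V : Type*} [Fintype V] {d : ℕ} {G₀ : SimpleGraph V}

theorem addCompletes_mem_regularClass (h : G₀ ∈ regularClass V d) (p : ℕ) :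
    addCompletes G₀ d p ∈ regularClass (V ⊕ Fin p × Fin (d + 1)) d := by
  classical
  refine mem_regularClass.2 fun v => ?_
  have h1 := SimpleGraph.degree_eq_sum_if_adj (addCompletes G₀ d p) (R := ℕ) v
  rw [Nat.cast_id] at h1
  rw [h1, Fintype.sum_sum_type]
  rcases v with v | ⟨q, a⟩
  · have h2 := SimpleGraph.degree_eq_sum_if_adj G₀ (R := ℕ) v
    rw [mem_regularClass.1 h, Nat.cast_id] at h2
    rw [h2]
    simp [addCompletes]
  · have h2 : ∀ x : Fin p × Fin (d + 1),
        (addCompletes G₀ d p).Adj (Sum.inr (q, a)) (Sum.inr x) ↔ q = x.1 ∧ a ≠ x.2 := fun x => by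
      simp [addCompletes, copiesOfComplete]
    have h3 : ∀ x : V, ¬ (addCompletes G₀ d p).Adj (Sum.inr (q, a)) (Sum.inl x) := fun x => by
      simp [addCompletes]
    simp only [h2, h3, if_false, Finset.sum_const_zero, zero_add, Fintype.sum_prod_type, ite_and]
    rw [Finset.sum_comm]
    simp only [Finset.sum_ite_eq, mem_univ, if_true]
    rw [Finset.sum_boole, Finset.filter_ne, Finset.card_erase_of_mem (mem_univ a)]
    simp

omit [Fintype V] in
theorem inCompleteComponent_addCompletes (p : ℕ) (x : Fin p × Fin (d + 1)) :
    InCompleteComponent (addCompletes G₀ d p) (Sum.inr x) := by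
  have hadj : ∀ x y : Fin p × Fin (d + 1),
      (addCompletes G₀ d p).Adj (Sum.inr x) (Sum.inr y) ↔ x.1 = y.1 ∧ x.2 ≠ y.2 := fun x y => by
    simp [addCompletes, copiesOfComplete]
  have hcl : ∀ x y : Fin p × Fin (d + 1), ((Sum.inr y : V ⊕ Fin p × Fin (d + 1)) = Sum.inr x ∨
      (addCompletes G₀ d p).Adj (Sum.inr x) (Sum.inr y)) ↔ x.1 = y.1 := by
    intro x y
    rw [hadj, Sum.inr.injEq, Prod.ext_iff]
    by_cases h : x.2 = y.2 <;> simp [h, eq_comm]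
  rintro (w | w) hw (y | y)
  · simp [addCompletes] at hw
  · simp [addCompletes] at hw
  · simp [addCompletes]
  · rw [hcl, hcl, ((hadj x w).1 hw).1]

theorem isOnlyTOptimal_compl_addCompletes (hreg : G₀ ∈ regularClass V d) (c p : ℕ)
    (hdiff : 1 ≤ p → ∀ H : SimpleGraph (V ⊕ Fin p × Fin (d + 1)),
      H.edgeSet.ncard = (addCompletes G₀ d p).edgeSet.ncard →
      ¬ Nonempty (H ≃g addCompletes G₀ d p) →
      ∃ j, FirstDiff (lapSeq (addCompletes G₀ d p)) (lapSeq H) j ∧ j ≤ c + 1)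
    (hcard : 2 * d + Fintype.card V * (2 * d) ^ (c + 2) ≤
      Fintype.card (V ⊕ Fin p × Fin (d + 1))) :
    IsOnlyTOptimal (addCompletes G₀ d p)ᶜ := by
  classical
  have hG := addCompletes_mem_regularClass hreg p
  have hW : Fintype.card (V ⊕ Fin p × Fin (d + 1)) = Fintype.card V + p * (d + 1) := by simp
  refine isOnlyTOptimal_compl fun H hH hiso => ?_
  rcases Nat.eq_zero_or_pos d with rfl | hd
  · have h0 := ncard_edgeSet_eq_zero_of_regular hG
    rw [h0] at hH
    rw [eq_bot_of_ncard_edgeSet_eq_zero h0, eq_bot_of_ncard_edgeSet_eq_zero hH] at hiso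
    exact absurd ⟨SimpleGraph.Iso.refl⟩ hiso
  have hpow : ∀ k, 1 ≤ (2 * d) ^ k := fun k => Nat.one_le_pow _ _ (by omega)
  -- For `p = 0` and `d ≥ 1` the size bound would exceed the number of vertices of `G₀`.
  have hp : 1 ≤ p := by
    by_contra hp0
    obtain rfl : p = 0 := by omega
    have := Nat.le_mul_of_pos_right (Fintype.card V) (hpow (c + 2))
    omega
  have : Nonempty (V ⊕ Fin p × Fin (d + 1)) := ⟨Sum.inr (⟨0, hp⟩, 0)⟩
  rcases (show 2 * d ≤ Fintype.card (V ⊕ Fin p × Fin (d + 1)) by omega).lt_or_eq with hn | hn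
  · obtain ⟨j, ⟨hj, hlt, hj'⟩, hjc⟩ := hdiff hp H hH hiso
    refine numSpanningTrees_compl_lt hG (univ.image Sum.inl) ?_ hH hj
      (fun i h1 h2 => (hlt i h1 h2).symm) hj' hn ?_
    · rintro (v | x) hv
      · simp at hv
      · exact inCompleteComponent_addCompletes p x
    · rw [Finset.card_image_of_injective _ Sum.inl_injective, Finset.card_univ]
      refine le_trans ?_ hcard
      have hle := Nat.mul_le_mul_left (Fintype.card V)
        (Nat.pow_le_pow_right (show 0 < 2 * d by omega) (show j + 1 ≤ c + 2 by omega))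
      omega
  -- The borderline `n = 2d` leaves only `p = 1` with `G₀` empty. The graph is then complete and
  -- alone in its edge class.
  · have hp1 : p = 1 := by
      by_contra hp1
      have : 2 * (d + 1) ≤ p * (d + 1) := Nat.mul_le_mul_right _ (by omega)
      omega
    have hV : Fintype.card V = 0 := by
      by_contra hV
      have := Nat.mul_le_mul (Nat.one_le_iff_ne_zero.2 hV) (hpow (c + 2))
      omega
    have hcompl := compl_mem_regularClass hG
    have h0 : Fintype.card (V ⊕ Fin p × Fin (d + 1)) - 1 - d = 0 := by
      rw [hW, hV, hp1]
      omega
    rw [h0] at hcompl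
    have h1 := ncard_edgeSet_eq_zero_of_regular hcompl
    have h2 := ncard_edgeSet_compl_eq hH
    rw [h1] at h2
    have h3 := (eq_bot_of_ncard_edgeSet_eq_zero h2).trans (eq_bot_of_ncard_edgeSet_eq_zero h1).symm
    rw [compl_inj_iff] at h3
    rw [h3] at hiso
    exact absurd ⟨SimpleGraph.Iso.refl⟩ hiso

end AddCompletes

end TOpt

open TOpt in
theorem theorem4p9 {V : Type*} [Fintype V] (d : ℕ) (G₀ : SimpleGraph V)
    (hreg : G₀ ∈ TOpt.regularClass V d)
    (hmin : ∀ p : ℕ, 1 ≤ p →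
      TOpt.IsOnlyTraceMinimal (Fintype.card (V ⊕ Fin p × Fin (d + 1)) - 1 - d)
        (TOpt.addCompletes G₀ d p)ᶜ) :
    (∃ n₀ : ℕ, 1 ≤ n₀ ∧ ∀ p : ℕ, n₀ ≤ Fintype.card (V ⊕ Fin p × Fin (d + 1)) →
      TOpt.IsOnlyTOptimal (TOpt.addCompletes G₀ d p)ᶜ) ∧
    ∀ c : ℕ, 1 ≤ c →
      (∀ p : ℕ, 1 ≤ p →
        ∀ H ∈ TOpt.edgeClass (V ⊕ Fin p × Fin (d + 1)) (TOpt.addCompletes G₀ d p).edgeSet.ncard,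
          ¬ Nonempty (H ≃g TOpt.addCompletes G₀ d p) →
          H ∉ TOpt.lapClass (V ⊕ Fin p × Fin (d + 1))
            (TOpt.addCompletes G₀ d p).edgeSet.ncard (c + 1)) →
      ∀ p : ℕ,
        2 * d + Fintype.card V * (2 * d) ^ (c + 2) ≤ Fintype.card (V ⊕ Fin p × Fin (d + 1)) →
          TOpt.IsOnlyTOptimal (TOpt.addCompletes G₀ d p)ᶜ := by
  classical
  refine ⟨?_, fun c hc hclass p hcard => ?_⟩
  -- `B` is the error of `lapSeq_succ_le` for the third moment (`m = 2`), and `2 * B + 4` is the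
  -- resulting bound of `firstDiff_le`. The final `+ 1` below only makes the threshold positive.
  · set B : ℕ := Fintype.card V * (2 * d) ^ 3 with hB
    refine ⟨2 * d + Fintype.card V * (2 * d) ^ (2 * B + 4 + 2) + 1, by omega, fun p hcard => ?_⟩
    refine isOnlyTOptimal_compl_addCompletes hreg (2 * B + 4) p (fun hp H hH hiso => ?_) (by omega)
    have hG := addCompletes_mem_regularClass hreg p
    obtain ⟨j, hj, hH' | rfl⟩ := exists_firstDiff_lapSeq hG (hmin p hp) hH hiso
    · refine ⟨j, hj, (firstDiff_le (C := B) hG hH' ?_ hj).trans (by omega)⟩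
      have h3 := lapSeq_succ_le hG (Finset.univ.image Sum.inl) (fun v hv => by
        rcases v with v | x
        · simp at hv
        · exact inCompleteComponent_addCompletes p x) 2
      rw [Finset.card_image_of_injective _ Sum.inl_injective, Finset.card_univ] at h3
      rw [hB]
      push_cast
      exact h3
    · exact ⟨2, hj, by omega⟩
  · refine isOnlyTOptimal_compl_addCompletes hreg c p (fun hp H hH hiso => ?_) hcard
    have hG := addCompletes_mem_regularClass hreg p
    obtain ⟨j, hj, -⟩ := exists_firstDiff_lapSeq hG (hmin p hp) hH hiso
    refine ⟨j, hj, ?_⟩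
    by_contra hlt
    -- The class of index `c + 1` consists of the graphs agreeing with `G₀(p)` up to `ℓ_{c+1}`, so a
    -- first difference beyond `c + 1` would put `H` in it.
    refine hclass p hp H hH hiso (((mem_lapClass_of_firstDiff (fun K hK => ?_) c).2 H hH).2
      fun i hi hic => hj.2.1 i hi (by omega))
    exact lapSeq_eq_or_exists_firstDiff hG (hmin p hp).1 hK
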